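/- Let $(W,S)$ and $(U,T)$ be Coxeter systems. If $W$ acts on a set $X$, a map $f\colon S\to X$ is called $W$-equivariant if $w s_1 w^{-1}=s_2$ with $s_1,s_2\in S$, $w\in W$ implies $w.f(s_1)=f(s_2)$. Let $\Phi_U\subset V_U$ be the root system of $(U,T)$ in its standard geometric representation, i.e. the set of all $w.\alpha_t$ ($w\in U$, $t\in T$), where $(\alpha_t)_{t\in T}$ is the basis of $V_U$ with $\langle\alpha_t,\alpha_{t'}\rangle=-\cos(\pi/m_{t,t'})$ (read as $-1$ if $m_{t,t'}=\infty$) and $t$ acts as the reflection $\sigma_{\alpha_t}$, $\sigma_\alpha(v)=v-2\langle\alpha,v\rangle\alpha$. A root subsystem is a (possibly empty) subset $\Psi\subseteq\Phi_U$ with $\sigma_\alpha(\Psi)\subseteq\Psi$ for all $\alpha\in\Psi$; $\langle X\rangle$ denotes the smallest root subsystem containing $X\subseteq \Phi_U$. The set $\Sigma(\Phi_U)$ of root subsystems is a commutative monoid under $\Psi_1\cdot\Psi_2=\langle\Psi_1\cup\Psi_2\rangle$, with unit $\emptyset$, in which all elements are idempotent, and $U$ acts on it by monoid automorphisms. A Juyumaya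 map is a pair $(\phi,e)$ consisting of a group homomorphism $\phi\colon W\to U$ and a map $e\colon S\to\Sigma(\Phi_U)$ that is $W$-equivariant for the action $\rho_\phi$ of $W$ on $\Sigma(\Phi_U)$ through $\phi$, such that $$\langle e_{s_1}\cup w.e_{s_2}\rangle=\langle e_{s_1}\cup (s_1w).e_{s_2}\rangle\qquad\text{for all } s_1,s_2\in S,\ w\in W.$$ Let $\Sigma(\Phi_U)_{[e]}$ be the submonoid of $\Sigma(\Phi_U)$ generated by the elements $w.e_s$ ($w\in W$, $s\in S$); it is $W$-stable and contains the image of $e$. A Marin–Iwahori–Hecke monoid is a triple $(E,\rho,e)$ of a commutative monoid $E$, an action $\rho$ of $W$ on $E$ by monoid automorphisms, and a $W$-equivariant map $e$ from $S$ to the idempotents of $E$ such that $e_s x=e_s(s.x)$ for all $s\in S$, $x\in E$. Let $k$ be a commutative ring, $A$ a commutative $k$-algebra with an action $\rho$ of $W$ by $k$-algebra automorphisms, and $a\colon S\to A^\times$ a $W$-equivariant map. Let $B_W$ be the Artin braid group of $(W,S)$, with generators $g_s$ ($s\in S$), acting on $A$ through $B_W\to W$; for $w\in W$ put $g_w=g_{s_1}\cdots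 g_{s_n}$, where $w=s_1\cdots s_n$ is any reduced expression (the result does not depend on it). The Marin algebra $\mathcal E^{(W,S)}(A,\rho,a)$ is the quotient of the semidirect product $A\rtimes k[B_W]$ (in which $gc=(g.c)g$ for $g\in B_W$, $c\in A$) by the two-sided ideal generated by $g_s^2-a_s-(1-a_s)g_s$, $s\in S$; it is a left $A$-module by multiplication. For a commutative ring $R$ with trivial $W$-action and a $W$-equivariant map $u\colon S\to R^\times$, the Iwahori–Hecke algebra is $H_R(W,S)(u_s)=\mathcal E^{(W,S)}(R,\mathrm{triv},u)$. **Theorem.** Let $(\phi,e)$ be a Juyumaya map between $(W,S)$ and $(U,T)$, let $R$ be a commutative ring with trivial $W$-action and $u\colon S\to R^\times$ a $W$-equivariant map. Then: 1. $(\Sigma(\Phi_U)_{[e]},\rho_\phi,e)$ is a Marin–Iwahori–Hecke monoid. 2. With the induced action of $W$ on the monoid algebra $R[\Sigma(\Phi_U)_{[e]}]$ and $\hat e_s=1+(u_s-1)e_s\in R[\Sigma(\Phi_U)_{[e]}]^\times$, the algebra $\mathcal E^{(W,S)}(R[\Sigma(\Phi_U)_{[e]}],\rho_\phi,\hat e)$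 is a free left $R[\Sigma(\Phi_U)_{[e]}]$-module with basis $\{g_w\mid w\in W\}$. 3. The augmentation $\epsilon\colon R[\Sigma(\Phi_U)_{[e]}]\to R$ (sending every element of $\Sigma(\Phi_U)_{[e]}$ to $1$) induces a surjective homomorphism of $R$-algebras $$\mathcal E^{(W,S)}(R[\Sigma(\Phi_U)_{[e]}],\rho_\phi,\hat e)\longrightarrow H_R(W,S)(u_s),$$ equal to $\epsilon$ on $R[\Sigma(\Phi_U)_{[e]}]$ and to the identity on $B_W$. -/

import Mathlib

noncomputable section

namespace BraidsTies

/-! ### Equivariant maps on the simple reflections -/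

section Equivariant

variable {B W X : Type*} [Group W] {M : CoxeterMatrix B}

/-- The set `S` of simple reflections is indexed by `B`. A map `f : S → X` into a set acted on by
`W` is equivariant if `w s₁ w⁻¹ = s₂` implies `w.f(s₁) = f(s₂)`, for `w ∈ W` and `s₁, s₂ ∈ S`. -/
def IsEquivariant (cs : CoxeterSystem M W) (act : W → X → X) (f : B → X) : Prop :=
  ∀ (w : W) (i j : B), w * cs.simple i * w⁻¹ = cs.simple j → act w (f i) = f j

end Equivariant

/-! ### The standard geometric representation and its root system -/

section Geometric

variable {B W : Type*} [Group W] (M : CoxeterMatrix B)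

/-- The symmetric bilinear form on `ℝ^(B)` with `⟨αᵢ, αⱼ⟩ = -cos (π / mᵢⱼ)`. The entry `mᵢⱼ = ∞` is
encoded by `0`, and then the value is `-cos 0 = -1`, as it should be. -/
def geomForm : (B →₀ ℝ) →ₗ[ℝ] (B →₀ ℝ) →ₗ[ℝ] ℝ :=
  Finsupp.linearCombination ℝ fun i =>
    Finsupp.linearCombination ℝ fun j => -Real.cos (Real.pi / (M i j : ℝ))

/-- The simple root `αᵢ`, a basis vector. -/
def simpleRoot (i : B) : B →₀ ℝ := Finsupp.single i 1

/-- `σ_α : v ↦ v - 2⟨α, v⟩ α`, the reflection associated with a unit vector `α`. -/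
def refl (α : B →₀ ℝ) : Module.End ℝ (B →₀ ℝ) :=
  Module.preReflection α ((2 : ℝ) • geomForm M α)

theorem refl_apply (α v : B →₀ ℝ) : refl M α v = v - (2 * geomForm M α v) • α := by
  simp [refl, Module.preReflection_apply]

theorem geomForm_simpleRoot (i j : B) :
    geomForm M (simpleRoot i) (simpleRoot j) = -Real.cos (Real.pi / (M i j : ℝ)) := by
  simp [geomForm, simpleRoot]

theorem geomForm_simpleRoot_self (i : B) :
    ((2 : ℝ) • geomForm M (simpleRoot i)) (simpleRoot i) = 2 := by
  simp [geomForm_simpleRoot]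

theorem geomForm_comm (v w : B →₀ ℝ) : geomForm M v w = geomForm M w v := by
  have h : geomForm M = (geomForm M).flip := by
    refine Finsupp.lhom_ext' fun i => LinearMap.ext_ring ?_
    refine Finsupp.lhom_ext' fun j => LinearMap.ext_ring ?_
    have h1 := geomForm_simpleRoot M i j
    have h2 := geomForm_simpleRoot M j i
    rw [M.symmetric j i] at h2
    simpa [simpleRoot] using h1.trans h2.symm
  exact congrArg (fun f => f v w) h

/-- The reflection in a simple root, as an automorphism. -/
def simpleReflection (i : B) : (B →₀ ℝ) ≃ₗ[ℝ] (B →₀ ℝ) :=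
  Module.reflection (geomForm_simpleRoot_self M i)

theorem simpleReflection_apply (i : B) (v : B →₀ ℝ) :
    simpleReflection M i v = refl M (simpleRoot i) v := rfl

open Polynomial.Chebyshev in
theorem simpleReflection_isLiftable : M.IsLiftable (simpleReflection M) := by
  intro i j
  by_cases hij : i = j
  · subst hij
    rw [M.diagonal, pow_one]
    ext1 v
    exact Module.involutive_reflection (geomForm_simpleRoot_self M i) v
  obtain hm0 | hm1 | hm2 | hm : M i j = 0 ∨ M i j = 1 ∨ M i j = 2 ∨ 3 ≤ M i j := by omega
  · rw [hm0, pow_zero]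
  · exact absurd hm1 (M.off_diagonal i j hij)
  · have hc : geomForm M (simpleRoot i) (simpleRoot j) = 0 := by
      simp [geomForm_simpleRoot, hm2]
    have hc' : geomForm M (simpleRoot j) (simpleRoot i) = 0 := by rw [geomForm_comm, hc]
    have h1 := geomForm_simpleRoot_self M i
    have h2 := geomForm_simpleRoot_self M j
    rw [hm2]
    ext1 v
    simp only [LinearMap.smul_apply, smul_eq_mul] at h1 h2
    simp only [pow_two, LinearEquiv.mul_apply, simpleReflection_apply, refl_apply, map_sub,
      map_smul, hc, hc']
    have h1' : geomForm M (simpleRoot i) (simpleRoot i) = 1 := by linarith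
    have h2' : geomForm M (simpleRoot j) (simpleRoot j) = 1 := by linarith
    rw [h1', h2']
    change _ = v
    module
  · set m := M i j with hmdef
    have hm0 : (m : ℝ) ≠ 0 := by positivity
    set θ : ℝ := 2 * Real.pi / m with hθ
    have hmθ : (m : ℝ) * θ = 2 * Real.pi := by rw [hθ]; field_simp
    have hsin : Real.sin θ ≠ 0 := by
      have h3 : (3 : ℝ) ≤ m := by exact_mod_cast hm
      have hpos : 0 < θ := by rw [hθ]; positivity
      have hlt : θ < Real.pi := by
        rw [hθ, div_lt_iff₀ (by positivity)]
        nlinarith [Real.pi_pos]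
      exact (Real.sin_pos_of_pos_of_lt_pi hpos hlt).ne'
    have hfy : ((2 : ℝ) • geomForm M (simpleRoot i)) (simpleRoot j)
        = -(2 * Real.cos (Real.pi / m)) := by
      simp [geomForm_simpleRoot, hmdef]
    have hgx : ((2 : ℝ) • geomForm M (simpleRoot j)) (simpleRoot i)
        = -(2 * Real.cos (Real.pi / m)) := by
      rw [← hfy]; simp [geomForm_comm M (simpleRoot j) (simpleRoot i)]
    have ht : 2 * Real.cos θ = ((2 : ℝ) • geomForm M (simpleRoot i)) (simpleRoot j) *
        ((2 : ℝ) • geomForm M (simpleRoot j)) (simpleRoot i) - 2 := by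
      rw [hfy, hgx, hθ, mul_div_assoc, Real.cos_two_mul]; ring
    ext1 v
    have key := Module.reflection_mul_reflection_pow_apply (geomForm_simpleRoot_self M i)
      (geomForm_simpleRoot_self M j) m v (2 * Real.cos θ) ht
    change ((Module.reflection (geomForm_simpleRoot_self M i) *
      Module.reflection (geomForm_simpleRoot_self M j)) ^ m) v = v
    rw [key]
    have hS (n : ℤ) := S_two_mul_real_cos θ n
    obtain ⟨k, hk | hk⟩ : ∃ k : ℕ, m = 2 * k ∨ m = 2 * k + 1 := ⟨m / 2, by omega⟩
    · have hz : (S ℝ ((k : ℤ) - 1)).eval (2 * Real.cos θ) = 0 := by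
        have h := hS ((k : ℤ) - 1)
        have h2 : ((((k : ℤ) - 1 : ℤ) : ℝ) + 1) * θ = Real.pi := by
          rw [hk] at hmθ; push_cast at hmθ ⊢; linarith
        rw [h2, Real.sin_pi] at h
        exact (mul_eq_zero.mp h).resolve_right hsin
      have e1 : ((m : ℤ) - 2) / 2 = (k : ℤ) - 1 := by omega
      have e2 : ((m : ℤ) - 1) / 2 = (k : ℤ) - 1 := by omega
      rw [e1, e2, hz]; simp
    · have hz : (S ℝ (k : ℤ)).eval (2 * Real.cos θ)
          + (S ℝ ((k : ℤ) - 1)).eval (2 * Real.cos θ) = 0 := by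
        have h := hS (k : ℤ)
        have h' := hS ((k : ℤ) - 1)
        have h2 : (((k : ℤ) : ℝ) + 1) * θ
            = 2 * Real.pi - ((((k : ℤ) - 1 : ℤ) : ℝ) + 1) * θ := by
          rw [hk] at hmθ; push_cast at hmθ ⊢; linarith
        rw [h2, Real.sin_two_pi_sub] at h
        have h3 : ((S ℝ (k : ℤ)).eval (2 * Real.cos θ)
          + (S ℝ ((k : ℤ) - 1)).eval (2 * Real.cos θ)) * Real.sin θ = 0 := by
          rw [add_mul, h, h']; ring
        exact (mul_eq_zero.mp h3).resolve_right hsin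
      have e1 : ((m : ℤ) - 2) / 2 = (k : ℤ) - 1 := by omega
      have e2 : ((m : ℤ) - 1) / 2 = (k : ℤ) := by omega
      have e3 : ((m : ℤ) - 3) / 2 = (k : ℤ) - 1 := by omega
      have e4 : (m : ℤ) / 2 = (k : ℤ) := by omega
      rw [e1, e2, e3, e4, hz]; simp

variable {M} (cs : CoxeterSystem M W)

/-- The standard geometric representation of a Coxeter system, `sᵢ ↦ σ_{αᵢ}`. -/
def geomRep : W →* ((B →₀ ℝ) ≃ₗ[ℝ] (B →₀ ℝ)) :=
  cs.lift ⟨simpleReflection M, simpleReflection_isLiftable M⟩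

theorem geomRep_simple (i : B) : geomRep cs (cs.simple i) = simpleReflection M i :=
  cs.lift_apply_simple (simpleReflection_isLiftable M) i

theorem geomForm_geomRep (w : W) (v v' : B →₀ ℝ) :
    geomForm M (geomRep cs w v) (geomRep cs w v') = geomForm M v v' := by
  induction w using cs.simple_induction generalizing v v' with
  | simple i =>
    have h1 := geomForm_simpleRoot_self M i
    simp only [LinearMap.smul_apply, smul_eq_mul] at h1
    have h1' : geomForm M (simpleRoot i) (simpleRoot i) = 1 := by linarith
    simp only [geomRep_simple, simpleReflection_apply, refl_apply, map_sub, map_smul,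
      LinearMap.sub_apply, LinearMap.smul_apply, smul_eq_mul, h1',
      geomForm_comm M v (simpleRoot i)]
    ring
  | one => simp
  | mul a b ha hb => simp only [map_mul, LinearEquiv.mul_apply, ha, hb]

theorem geomRep_refl (w : W) (α v : B →₀ ℝ) :
    geomRep cs w (refl M α v) = refl M (geomRep cs w α) (geomRep cs w v) := by
  simp [refl_apply, geomForm_geomRep]

/-- The root system `Φ = {w.αᵢ}`. -/
def roots : Set (B →₀ ℝ) := {v | ∃ (w : W) (i : B), v = geomRep cs w (simpleRoot i)}

theorem geomRep_mem_roots (w : W) {v : B →₀ ℝ} (hv : v ∈ roots cs) :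
    geomRep cs w v ∈ roots cs := by
  obtain ⟨w', i, rfl⟩ := hv
  exact ⟨w * w', i, by simp⟩

theorem refl_mem_roots {α β : B →₀ ℝ} (hα : α ∈ roots cs) (hβ : β ∈ roots cs) :
    refl M α β ∈ roots cs := by
  obtain ⟨w, i, rfl⟩ := hα
  have h : refl M (geomRep cs w (simpleRoot i)) β
      = geomRep cs (w * cs.simple i * w⁻¹) β := by
    have hβ' : β = geomRep cs w (geomRep cs w⁻¹ β) := by
      rw [← LinearEquiv.mul_apply, ← map_mul]; simp
    conv_lhs => rw [hβ', ← geomRep_refl]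
    simp only [map_mul, LinearEquiv.mul_apply, geomRep_simple, simpleReflection_apply]
  rw [h]
  exact geomRep_mem_roots cs _ hβ

/-! ### The monoid of root subsystems -/

/-- A root subsystem of `Φ`: a subset `Ψ ⊆ Φ` stable under the reflections in its own elements
(hence also under `α ↦ -α = σ_α(α)`). The empty set is one. -/
@[ext]
structure RootSubsystem where
  /-- The underlying set of roots. -/
  carrier : Set (B →₀ ℝ)
  subset_roots : carrier ⊆ roots cs
  refl_mem : ∀ ⦃α⦄, α ∈ carrier → ∀ ⦃β⦄, β ∈ carrier → refl M α β ∈ carrier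

namespace RootSubsystem

variable {cs}

/-- `⟨X⟩`, the root subsystem generated by a set `X ⊆ Φ` of roots: the intersection of all root
subsystems containing `X`. -/
def generate (X : Set (B →₀ ℝ)) : RootSubsystem cs where
  carrier := {v | v ∈ roots cs ∧ ∀ Ψ : RootSubsystem cs, X ⊆ Ψ.carrier → v ∈ Ψ.carrier}
  subset_roots := fun _ h => h.1
  refl_mem := fun _ hα _ hβ =>
    ⟨refl_mem_roots cs hα.1 hβ.1, fun Ψ hΨ => Ψ.refl_mem (hα.2 Ψ hΨ) (hβ.2 Ψ hΨ)⟩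

theorem subset_generate {X : Set (B →₀ ℝ)} (hX : X ⊆ roots cs) :
    X ⊆ (generate X : RootSubsystem cs).carrier :=
  fun _ hv => ⟨hX hv, fun _ hΨ => hΨ hv⟩

theorem generate_subset {X : Set (B →₀ ℝ)} {Ψ : RootSubsystem cs} (h : X ⊆ Ψ.carrier) :
    (generate X : RootSubsystem cs).carrier ⊆ Ψ.carrier :=
  fun _ hv => hv.2 Ψ h

/-- The product `Ψ₁ · Ψ₂ = ⟨Ψ₁, Ψ₂⟩`. -/
instance : Mul (RootSubsystem cs) := ⟨fun Ψ₁ Ψ₂ => generate (Ψ₁.carrier ∪ Ψ₂.carrier)⟩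

/-- The unit is the empty root subsystem. -/
instance : One (RootSubsystem cs) :=
  ⟨{ carrier := ∅
     subset_roots := Set.empty_subset _
     refl_mem := fun _ h => h.elim }⟩

theorem mul_def (Ψ₁ Ψ₂ : RootSubsystem cs) :
    Ψ₁ * Ψ₂ = generate (Ψ₁.carrier ∪ Ψ₂.carrier) := rfl

theorem one_carrier : (1 : RootSubsystem cs).carrier = ∅ := rfl

theorem left_subset_mul (Ψ₁ Ψ₂ : RootSubsystem cs) : Ψ₁.carrier ⊆ (Ψ₁ * Ψ₂).carrier :=
  Set.subset_union_left.trans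
    (subset_generate (Set.union_subset Ψ₁.subset_roots Ψ₂.subset_roots))

theorem right_subset_mul (Ψ₁ Ψ₂ : RootSubsystem cs) : Ψ₂.carrier ⊆ (Ψ₁ * Ψ₂).carrier :=
  Set.subset_union_right.trans
    (subset_generate (Set.union_subset Ψ₁.subset_roots Ψ₂.subset_roots))

theorem mul_subset {Ψ₁ Ψ₂ Ψ : RootSubsystem cs} (h₁ : Ψ₁.carrier ⊆ Ψ.carrier)
    (h₂ : Ψ₂.carrier ⊆ Ψ.carrier) : (Ψ₁ * Ψ₂).carrier ⊆ Ψ.carrier :=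
  generate_subset (Set.union_subset h₁ h₂)

theorem mul_self (Ψ : RootSubsystem cs) : Ψ * Ψ = Ψ :=
  RootSubsystem.ext ((mul_subset subset_rfl subset_rfl).antisymm (left_subset_mul Ψ Ψ))

instance : CommMonoid (RootSubsystem cs) where
  mul_assoc a b c := by
    refine RootSubsystem.ext (Set.Subset.antisymm ?_ ?_)
    · refine mul_subset (mul_subset (left_subset_mul _ _) ?_) ?_
      · exact (left_subset_mul b c).trans (right_subset_mul a _)
      · exact (right_subset_mul b c).trans (right_subset_mul a _)
    · refine mul_subset ?_ (mul_subset ?_ (right_subset_mul _ _))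
      · exact (left_subset_mul a b).trans (left_subset_mul _ c)
      · exact (right_subset_mul a b).trans (left_subset_mul _ c)
  one_mul a := RootSubsystem.ext
    ((mul_subset (Set.empty_subset _) subset_rfl).antisymm (right_subset_mul _ _))
  mul_one a := RootSubsystem.ext
    ((mul_subset subset_rfl (Set.empty_subset _)).antisymm (left_subset_mul _ _))
  mul_comm a b := RootSubsystem.ext
    ((mul_subset (right_subset_mul _ _) (left_subset_mul _ _)).antisymm
      (mul_subset (right_subset_mul _ _) (left_subset_mul _ _)))

/-- The action of an element `w` on root subsystems: `w.Ψ = {w.α | α ∈ Ψ}`. -/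
def translate (w : W) (Ψ : RootSubsystem cs) : RootSubsystem cs where
  carrier := geomRep cs w '' Ψ.carrier
  subset_roots := by
    rintro _ ⟨v, hv, rfl⟩
    exact geomRep_mem_roots cs w (Ψ.subset_roots hv)
  refl_mem := by
    rintro _ ⟨α, hα, rfl⟩ _ ⟨β, hβ, rfl⟩
    exact ⟨_, Ψ.refl_mem hα hβ, geomRep_refl cs w α β⟩

theorem translate_one (Ψ : RootSubsystem cs) : translate 1 Ψ = Ψ := by
  ext v; simp [translate]

theorem translate_mul (w w' : W) (Ψ : RootSubsystem cs) :
    translate (w * w') Ψ = translate w (translate w' Ψ) := by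
  ext v; simp [translate]

theorem translate_mono (w : W) {Ψ Ψ' : RootSubsystem cs} (h : Ψ.carrier ⊆ Ψ'.carrier) :
    (translate w Ψ).carrier ⊆ (translate w Ψ').carrier :=
  Set.image_mono h

theorem translate_prod (w : W) (Ψ Ψ' : RootSubsystem cs) :
    translate w (Ψ * Ψ') = translate w Ψ * translate w Ψ' := by
  have hge (w : W) (Ψ Ψ' : RootSubsystem cs) :
      (translate w Ψ * translate w Ψ').carrier ⊆ (translate w (Ψ * Ψ')).carrier :=
    mul_subset (translate_mono w (left_subset_mul _ _)) (translate_mono w (right_subset_mul _ _))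
  refine RootSubsystem.ext (Set.Subset.antisymm ?_ (hge w Ψ Ψ'))
  have h := translate_mono w (hge w⁻¹ (translate w Ψ) (translate w Ψ'))
  simpa only [← translate_mul, inv_mul_cancel, mul_inv_cancel, translate_one] using h

/-- The canonical action of the Coxeter group on the monoid of root subsystems, by monoid
automorphisms. -/
def action (cs : CoxeterSystem M W) : W →* MulAut (RootSubsystem cs) where
  toFun w :=
    { toFun := translate w
      invFun := translate w⁻¹
      left_inv := fun Ψ => by rw [← translate_mul, inv_mul_cancel, translate_one]
      right_inv := fun Ψ => by rw [← translate_mul, mul_inv_cancel, translate_one]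
      map_mul' := translate_prod w }
  map_one' := MulEquiv.ext translate_one
  map_mul' w w' := MulEquiv.ext (translate_mul w w')

end RootSubsystem

end Geometric

/-! ### Marin–Iwahori–Hecke monoids -/

section Monoids

variable {B W E : Type*} [Group W] {M : CoxeterMatrix B} [CommMonoid E]

/-- `(E, ρ, e)` is a Marin–Iwahori–Hecke monoid: `e` is an equivariant map from `S` to the
idempotents of `E`, and `e_s (1 - ρ_s) = 0`, that is `e_s x = e_s (s.x)` for all `x ∈ E`. -/
structure IsMarinIwahoriHeckeMonoid (cs : CoxeterSystem M W) (ρ : W →* MulAut E) (e : B → E) :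
    Prop where
  idempotent : ∀ i, IsIdempotentElem (e i)
  equivariant : IsEquivariant cs (fun w x => ρ w x) e
  mul_eq : ∀ i x, e i * x = e i * ρ (cs.simple i) x

/-- `E_[e]`, the submonoid generated by the elements `w.e_s`, for `w ∈ W` and `s ∈ S`. -/
def orbitSubmonoid (ρ : W →* MulAut E) (e : B → E) : Submonoid E :=
  Submonoid.closure {x | ∃ (w : W) (i : B), x = ρ w (e i)}

theorem orbitSubmonoid_stable (ρ : W →* MulAut E) (e : B → E) (w : W) {x : E}
    (hx : x ∈ orbitSubmonoid ρ e) : ρ w x ∈ orbitSubmonoid ρ e := by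
  have h : orbitSubmonoid ρ e ≤ (orbitSubmonoid ρ e).comap (ρ w).toMonoidHom := by
    refine Submonoid.closure_le.mpr ?_
    rintro _ ⟨w', i, rfl⟩
    exact Submonoid.subset_closure ⟨w * w', i, by simp⟩
  exact h hx

/-- The restriction of the action `ρ` to `E_[e]`. -/
def orbitAction (ρ : W →* MulAut E) (e : B → E) : W →* MulAut (orbitSubmonoid ρ e) where
  toFun w :=
    { toFun := fun x => ⟨ρ w x, orbitSubmonoid_stable ρ e w x.2⟩
      invFun := fun x => ⟨ρ w⁻¹ x, orbitSubmonoid_stable ρ e w⁻¹ x.2⟩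
      left_inv := fun x => Subtype.ext (by simp)
      right_inv := fun x => Subtype.ext (by simp)
      map_mul' := fun x y => Subtype.ext (by simp) }
  map_one' := by ext x; simp
  map_mul' w w' := by ext x; simp

/-- The map `e`, with values in `E_[e]`. -/
def orbitMap (ρ : W →* MulAut E) (e : B → E) (i : B) : orbitSubmonoid ρ e :=
  ⟨e i, Submonoid.subset_closure ⟨1, i, by simp⟩⟩

end Monoids

/-! ### The Artin braid group -/

section Artin

variable {B W : Type*} [Group W] (M : CoxeterMatrix B)

/-- The braid relations `sᵢsⱼsᵢ⋯ = sⱼsᵢsⱼ⋯` (`mᵢⱼ` factors on each side). There is no relation for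
`mᵢⱼ = ∞`, encoded by `0`: both words are then empty. -/
def artinRelations : Set (FreeGroup B) :=
  {r | ∃ i j : B, r = ((CoxeterSystem.braidWord M i j).map FreeGroup.of).prod *
    (((CoxeterSystem.braidWord M j i).map FreeGroup.of).prod)⁻¹}

/-- The Artin braid group of the Coxeter matrix `M`. -/
abbrev ArtinGroup : Type _ := PresentedGroup (artinRelations M)

/-- The product `g_{s₁} ⋯ g_{sₖ}` in the Artin group of the generators along a word. On the reduced
words of `w` it is the canonical lift `g_w` of `w ∈ W`. -/
def artinWord (ω : List B) : ArtinGroup M :=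
  (ω.map fun i => (PresentedGroup.of i : ArtinGroup M)).prod

variable {M}

/-- The projection of the Artin group onto the Coxeter group. -/
def artinProj (cs : CoxeterSystem M W) : ArtinGroup M →* W :=
  PresentedGroup.toGroup (f := cs.simple) (by
    rintro _ ⟨i, j, rfl⟩
    have h := cs.wordProd_braidWord_eq i j
    simp only [CoxeterSystem.wordProd] at h
    simp only [map_mul, map_inv, map_list_prod, List.map_map, Function.comp_def,
      FreeGroup.lift_apply_of]
    rw [mul_inv_eq_one]
    exact h)

end Artin

/-! ### Marin data and Marin algebras -/

section Marin

variable {B W : Type*} [Group W] {M : CoxeterMatrix B}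

/-- A Marin datum with Coxeter system `cs`: an action of `W` on the commutative `k`-algebra `A` and an
equivariant map `a : S → Aˣ`. -/
structure MarinDatum (cs : CoxeterSystem M W) (k A : Type*) [CommRing k] [CommRing A]
    [Algebra k A] where
  /-- The action of `W` on `A`. -/
  ρ : W →* (A ≃ₐ[k] A)
  /-- The equivariant map. -/
  a : B → Aˣ
  equivariant : IsEquivariant cs (fun w x => Units.map (ρ w : A →* A) x) a

namespace MarinDatum

variable {cs : CoxeterSystem M W} {k A : Type*} [CommRing k] [CommRing A] [Algebra k A]

/-- The algebra `A` of a Marin datum, carrying the action of the Artin group through `W`. -/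
def Coeff (_D : MarinDatum cs k A) : Type _ := A

variable (D : MarinDatum cs k A)

instance : CommRing D.Coeff := inferInstanceAs (CommRing A)

instance : Algebra k D.Coeff := inferInstanceAs (Algebra k A)

/-- The identity map from `A` to `D.Coeff`. -/
def toCoeff : A ≃ₐ[k] D.Coeff := AlgEquiv.refl

instance : MulSemiringAction (ArtinGroup M) D.Coeff where
  smul x c := D.toCoeff (D.ρ (artinProj cs x) (D.toCoeff.symm c))
  one_smul c := by
    change D.toCoeff (D.ρ (artinProj cs 1) (D.toCoeff.symm c)) = c
    simp
  mul_smul x y c := by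
    change D.toCoeff (D.ρ (artinProj cs (x * y)) (D.toCoeff.symm c)) =
      D.toCoeff (D.ρ (artinProj cs x) (D.toCoeff.symm
        (D.toCoeff (D.ρ (artinProj cs y) (D.toCoeff.symm c)))))
    simp
  smul_zero x := by
    change D.toCoeff (D.ρ (artinProj cs x) (D.toCoeff.symm 0)) = 0
    simp
  smul_add x c d := by
    change D.toCoeff (D.ρ (artinProj cs x) (D.toCoeff.symm (c + d))) =
      D.toCoeff (D.ρ (artinProj cs x) (D.toCoeff.symm c)) +
      D.toCoeff (D.ρ (artinProj cs x) (D.toCoeff.symm d))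
    simp
  smul_one x := by
    change D.toCoeff (D.ρ (artinProj cs x) (D.toCoeff.symm 1)) = 1
    simp
  smul_mul x c d := by
    change D.toCoeff (D.ρ (artinProj cs x) (D.toCoeff.symm (c * d))) =
      D.toCoeff (D.ρ (artinProj cs x) (D.toCoeff.symm c)) *
      D.toCoeff (D.ρ (artinProj cs x) (D.toCoeff.symm d))
    simp

theorem artin_smul_def (x : ArtinGroup M) (c : D.Coeff) :
    x • c = D.toCoeff (D.ρ (artinProj cs x) (D.toCoeff.symm c)) := rfl

instance : SMulCommClass (ArtinGroup M) k D.Coeff where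
  smul_comm x r c := by simp [artin_smul_def]

/-- The semidirect product `A ⋊ k[B_W]`: sums of elements `c g` with `c ∈ A` and `g ∈ B_W`, with the
rule `g c = (g.c) g`. -/
abbrev Semidirect : Type _ := SkewMonoidAlgebra D.Coeff (ArtinGroup M)

/-- The relations `g_s² = a_s + (1 - a_s) g_s`, for `s ∈ S`. -/
inductive Rel : D.Semidirect → D.Semidirect → Prop
  | quadratic (i : B) :
      Rel (SkewMonoidAlgebra.single (PresentedGroup.of i) 1 ^ 2)
        (SkewMonoidAlgebra.single 1 (D.toCoeff (D.a i)) +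
          SkewMonoidAlgebra.single 1 (1 - D.toCoeff (D.a i)) *
            SkewMonoidAlgebra.single (PresentedGroup.of i) 1)

/-- The Marin algebra of the datum: the quotient of `A ⋊ k[B_W]` by the two-sided ideal generated by
the elements `g_s² - a_s - (1 - a_s) g_s`. -/
def MarinAlgebra : Type _ := RingQuot D.Rel

instance : Ring D.MarinAlgebra := inferInstanceAs (Ring (RingQuot D.Rel))

instance : Algebra k D.MarinAlgebra := inferInstanceAs (Algebra k (RingQuot D.Rel))

/-- The quotient map. -/
def quotientMap : D.Semidirect →ₐ[k] D.MarinAlgebra := RingQuot.mkAlgHom k D.Rel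

/-- The canonical map from `A` to the Marin algebra. -/
def coeffHom : D.Coeff →+* D.MarinAlgebra :=
  (D.quotientMap : D.Semidirect →+* D.MarinAlgebra).comp SkewMonoidAlgebra.singleOneRingHom

/-- The canonical map from the Artin group to the Marin algebra. -/
def gen : ArtinGroup M →* D.MarinAlgebra :=
  (D.quotientMap : D.Semidirect →* D.MarinAlgebra).comp (SkewMonoidAlgebra.of D.Coeff (ArtinGroup M))

/-- The left `A`-module structure of the Marin algebra: `c • x = c x`. -/
instance : Module D.Coeff D.MarinAlgebra := Module.compHom D.MarinAlgebra D.coeffHom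

end MarinDatum

/-- The Marin datum `(R, trivial action, u)`. -/
def heckeDatum (cs : CoxeterSystem M W) {R : Type*} [CommRing R] (u : B → Rˣ)
    (hu : IsEquivariant cs (fun _ r => r) u) : MarinDatum cs R R where
  ρ := 1
  a := u
  equivariant := fun w i j h => by
    rw [← hu w i j h]
    ext
    simp

/-- The Iwahori–Hecke algebra `H_R(W,S)(u_s)`: the `R`-algebra on generators `g_s`, subject to the
braid relations and to `g_s² = u_s + (1 - u_s) g_s`. -/
abbrev IwahoriHeckeAlgebra (cs : CoxeterSystem M W) {R : Type*} [CommRing R] (u : B → Rˣ)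
    (hu : IsEquivariant cs (fun _ r => r) u) : Type _ :=
  (heckeDatum cs u hu).MarinAlgebra

variable {E : Type*} [CommMonoid E]

/-- The unit `ê_s = 1 + (u_s - 1) e_s` of `R[E]`, for an idempotent `e_s` of `E`. -/
def hatUnit {R : Type*} [CommRing R] (u : Rˣ) (e : E) (he : IsIdempotentElem e) :
    (MonoidAlgebra R E)ˣ where
  val := 1 + MonoidAlgebra.single e ((u : R) - 1)
  inv := 1 + MonoidAlgebra.single e (((u⁻¹ : Rˣ) : R) - 1)
  val_inv := by
    have h : ((u : R) - 1) * (((u⁻¹ : Rˣ) : R) - 1)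
        = -(((u : R) - 1) + (((u⁻¹ : Rˣ) : R) - 1)) := by
      linear_combination u.mul_inv
    rw [add_mul, mul_add, mul_add, MonoidAlgebra.single_mul_single, he.eq, h,
      MonoidAlgebra.single_neg, MonoidAlgebra.single_add]
    simp only [one_mul, mul_one]
    abel
  inv_val := by
    have h : (((u⁻¹ : Rˣ) : R) - 1) * ((u : R) - 1)
        = -(((u : R) - 1) + (((u⁻¹ : Rˣ) : R) - 1)) := by
      linear_combination u.mul_inv
    rw [add_mul, mul_add, mul_add, MonoidAlgebra.single_mul_single, he.eq, h,
      MonoidAlgebra.single_neg, MonoidAlgebra.single_add]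
    simp only [one_mul, mul_one]
    abel

/-- The action of `W` on `R[E]` induced by an action on the commutative monoid `E`. -/
def monoidAlgebraAction (R : Type*) [CommRing R] (ρ : W →* MulAut E) :
    W →* (MonoidAlgebra R E ≃ₐ[R] MonoidAlgebra R E) where
  toFun w := MonoidAlgebra.domCongr R R (ρ w)
  map_one' := by
    ext f x
    simp
    rfl
  map_mul' w w' := by
    ext f x
    simp
    rfl

/-- The Marin datum `(R[E], ρ, ê)` attached to a commutative monoid `E` with an action `ρ` and an
equivariant map `e` from `S` to the idempotents of `E`. -/
def monoidDatum (cs : CoxeterSystem M W) {R : Type*} [CommRing R] (ρ : W →* MulAut E) (e : B → E)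
    (he : ∀ i, IsIdempotentElem (e i)) (heq : IsEquivariant cs (fun w x => ρ w x) e)
    (u : B → Rˣ) (hu : IsEquivariant cs (fun _ r => r) u) :
    MarinDatum cs R (MonoidAlgebra R E) where
  ρ := monoidAlgebraAction R ρ
  a i := hatUnit (u i) (e i) (he i)
  equivariant := fun w i j h => by
    have h1 := hu w i j h
    have h2 := heq w i j h
    ext1
    simp only at h1 h2
    simp [hatUnit, monoidAlgebraAction, h1, h2]

/-- The augmentation `R[E] → R`, sending all elements of `E` to `1`. -/
def augmentation (R E : Type*) [CommRing R] [CommMonoid E] : MonoidAlgebra R E →ₐ[R] R :=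
  MonoidAlgebra.lift R R E 1

end Marin

/-! ### Juyumaya maps -/

section Juyumaya

variable {B W B' U : Type*} [Group W] [Group U] {M : CoxeterMatrix B} {N : CoxeterMatrix B'}

/-- The action `ρ_φ` of `W` on the root subsystems of `Φ_U` through `φ : W → U`. -/
def rhoPhi (ct : CoxeterSystem N U) (φ : W →* U) : W →* MulAut (RootSubsystem ct) :=
  (RootSubsystem.action ct).comp φ

/-- `(φ, e)` is a Juyumaya map between `(W,S)` and `(U,T)`: `e : S → Σ(Φ_U)` is equivariant via `φ`
and `⟨e_{s₁}, w.e_{s₂}⟩ = ⟨e_{s₁}, (s₁w).e_{s₂}⟩` for all `s₁, s₂ ∈ S` and `w ∈ W`. -/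
structure IsJuyumayaMap (cs : CoxeterSystem M W) (ct : CoxeterSystem N U) (φ : W →* U)
    (e : B → RootSubsystem ct) : Prop where
  equivariant : IsEquivariant cs (fun w Ψ => rhoPhi ct φ w Ψ) e
  generate_eq : ∀ (i j : B) (w : W),
    (RootSubsystem.generate ((e i).carrier ∪ (rhoPhi ct φ w (e j)).carrier) : RootSubsystem ct) =
      RootSubsystem.generate
        ((e i).carrier ∪ (rhoPhi ct φ (cs.simple i * w) (e j)).carrier)

/-- `Σ(Φ_U)_[e]`. -/
abbrev SigmaOrbit (ct : CoxeterSystem N U) (φ : W →* U) (e : B → RootSubsystem ct) :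
    Submonoid (RootSubsystem ct) :=
  orbitSubmonoid (rhoPhi ct φ) e

/-- The Marin datum `(R[Σ(Φ_U)_[e]], ρ_φ, ê)` of a Juyumaya map. -/
def juyumayaDatum {cs : CoxeterSystem M W} {ct : CoxeterSystem N U} {φ : W →* U}
    {e : B → RootSubsystem ct} (h : IsJuyumayaMap cs ct φ e) {R : Type*} [CommRing R]
    (u : B → Rˣ) (hu : IsEquivariant cs (fun _ r => r) u) :
    MarinDatum cs R (MonoidAlgebra R (SigmaOrbit ct φ e)) :=
  monoidDatum cs (orbitAction (rhoPhi ct φ) e) (orbitMap (rhoPhi ct φ) e)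
    (fun i => Subtype.ext (RootSubsystem.mul_self (e i)))
    (fun w i j hw => Subtype.ext (h.equivariant w i j hw)) u hu

end Juyumaya

end BraidsTies

end

open BraidsTies

/-! The monoid statement is a reduction to generators. Since `e_s` is idempotent, `e_s (x y) = (e_s
x)(e_s y)`, so the elements `x` with `e_s x = e_s (s.x)` are closed under products, and for `x =
w.e_t` this equation is the Juyumaya condition (`isMarinIwahoriHeckeMonoid_orbit`).

The basis statement holds for every Marin datum with `(1 - a_s)(s.c) = (1 - a_s) c`
(`MarinDatum.IsCompatible`). Here `1 - ê_s = (1 - u_s) e_s`, so the condition follows from the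
monoid statement. That the `g_w` span is a consequence of the quadratic relations and the
invertibility of `a_s`. For independence, the algebra is made to act on the free module over `W` by
the expected formulas for left multiplication by `g_s` (`leftOp`); evaluating at the basis vector
`1` then sends `g_w` to the basis vector `w`. The quadratic relations are a direct check. For the
braid relations, operators of right multiplication (`rightOp`) are introduced. They commute with the
left ones (`leftOp_rightOp`) and reach every basis vector from `1`, so a product of left operators
is determined by its value at `1` and its twist on coefficients (`prod_leftOp_ext`). The two sides
of a braid relation are reduced words of the same element, so these data agree.

The Coxeter combinatorics behind this is the exchange condition, obtained from the parity of
multiplicities in left inversion sequences, and the fact that `s_i s_j` has order exactly `m_ij`,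
read off from the geometric representation. Together they also give Matsumoto's theorem
(`prod_map_eq_of_isReduced`), by which `g_w` is well defined.

For the last statement, the augmentation is `W`-invariant and sends `ê_s` to `u_s`, so it induces a
map of Marin algebras, surjective because the augmentation is. -/

noncomputable section

namespace BraidsTies

open CoxeterSystem

/-! ### The order of a product of two simple reflections -/

section Order

variable {B W : Type*} [Group W] {M : CoxeterMatrix B} (cs : CoxeterSystem M W)

-- In the geometric representation `s_i s_j` acts on the plane of `α_i, α_j` as a product of two
-- reflections, whose powers have Chebyshev polynomials in `2 cos (2π/m)` as coefficients. If the
-- `k`-th power fixes `α_i`, comparing the coefficients of `α_i` and `α_j` gives the divisibility.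
open Polynomial.Chebyshev in
theorem dvd_of_simple_mul_simple_pow_eq_one {i j : B} (hij : i ≠ j) {k : ℕ}
    (hk : (cs.simple i * cs.simple j) ^ k = 1) : M i j ∣ k := by
  set m := M i j with hm
  set θ : ℝ := 2 * Real.pi / m with hθ
  have hfy : ((2 : ℝ) • geomForm M (simpleRoot i)) (simpleRoot j)
      = -(2 * Real.cos (Real.pi / m)) := by
    simp [geomForm_simpleRoot, hm]
  have hgx : ((2 : ℝ) • geomForm M (simpleRoot j)) (simpleRoot i)
      = -(2 * Real.cos (Real.pi / m)) := by
    rw [← hfy]; simp [geomForm_comm M (simpleRoot j) (simpleRoot i)]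
  have ht : 2 * Real.cos θ = ((2 : ℝ) • geomForm M (simpleRoot i)) (simpleRoot j) *
      ((2 : ℝ) • geomForm M (simpleRoot j)) (simpleRoot i) - 2 := by
    rw [hfy, hgx, hθ, mul_div_assoc, Real.cos_two_mul]; ring
  have key := Module.reflection_mul_reflection_pow_apply_self (geomForm_simpleRoot_self M i)
    (geomForm_simpleRoot_self M j) k (2 * Real.cos θ) ht
  have hrep : (Module.reflection (geomForm_simpleRoot_self M i) *
      Module.reflection (geomForm_simpleRoot_self M j)) ^ k = 1 := by
    have h := congrArg (geomRep cs) hk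
    rwa [map_pow, map_mul, geomRep_simple, geomRep_simple, map_one] at h
  rw [hrep, hgx] at key
  have h1 := DFunLike.congr_fun key i
  have h2 := DFunLike.congr_fun key j
  simp [simpleRoot, hij, hij.symm] at h1 h2
  have hm1 : m ≠ 1 := M.off_diagonal i j hij
  obtain h0 | h0 | h0 : m = 0 ∨ m = 2 ∨ 3 ≤ m := by omega
  -- Here `m = 0` stands for `∞`. Division by zero gives `θ = 0`, and `S_{k-1}(2) = k` must vanish.
  · rw [h0] at hθ h2 ⊢
    simp [hθ, S_eval_two] at h2
    simp [h2]
  -- For `m = 2` the coefficient of `α_j` carries the factor `cos (π/2) = 0` and says nothing; the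
  -- coefficient of `α_i` is `(-1)^k`.
  · have hθ' : θ = Real.pi := by rw [hθ, h0]; push_cast; ring
    rw [hθ', Real.cos_pi, show (2 : ℝ) * -1 = -2 by norm_num, S_eval_neg_two, S_eval_neg_two,
      Int.negOnePow_sub] at h1
    rw [h0]
    by_contra hk2
    have hodd : Odd (k : ℤ) := by
      rw [Int.odd_coe_nat]; exact Nat.not_even_iff_odd.mp fun h => hk2 h.two_dvd
    rw [Int.negOnePow_odd _ hodd] at h1
    simp at h1
    linarith
  -- Now `cos (π/m) ≠ 0`, so `S_{k-1} = 0` and `S_k = 1`. Multiplied by `sin θ` these read `sin kθ =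
  -- 0` and `sin (k+1)θ = sin θ`, whence `cos kθ = 1`.
  · have h3 : (3 : ℝ) ≤ m := by exact_mod_cast h0
    have hm0 : (m : ℝ) ≠ 0 := by positivity
    have hsin : Real.sin θ ≠ 0 := by
      have hpos : 0 < θ := by rw [hθ]; positivity
      have hlt : θ < Real.pi := by
        rw [hθ, div_lt_iff₀ (by positivity)]
        nlinarith [Real.pi_pos]
      exact (Real.sin_pos_of_pos_of_lt_pi hpos hlt).ne'
    have hcos : Real.cos (Real.pi / m) ≠ 0 := by
      refine (Real.cos_pos_of_mem_Ioo ⟨?_, ?_⟩).ne'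
      · have : 0 < Real.pi / m := by positivity
        linarith [Real.pi_pos]
      · rw [div_lt_div_iff₀ (by positivity) (by norm_num)]
        nlinarith [Real.pi_pos]
    have hz : (S ℝ ((k : ℤ) - 1)).eval (2 * Real.cos θ) = 0 := by tauto
    rw [hz, add_zero] at h1
    have hS := S_two_mul_real_cos θ (k : ℤ)
    have hS' := S_two_mul_real_cos θ ((k : ℤ) - 1)
    rw [hz] at hS'
    rw [← h1] at hS
    push_cast at hS hS'
    rw [add_mul, Real.sin_add] at hS
    simp only [one_mul, sub_add_cancel, zero_mul] at hS hS'
    rw [← hS', zero_mul, zero_add] at hS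
    have hc : Real.cos (k * θ) = 1 := by
      have : (Real.cos (k * θ) - 1) * Real.sin θ = 0 := by linarith
      linarith [(mul_eq_zero.mp this).resolve_right hsin]
    obtain ⟨n, hn⟩ := (Real.cos_eq_one_iff _).mp hc
    have hkn : (k : ℝ) = n * m := by
      rw [hθ] at hn
      field_simp at hn
      exact hn.symm
    have hkn' : (k : ℤ) = m * n := by rw [mul_comm]; exact_mod_cast hkn
    exact Int.natCast_dvd_natCast.mp ⟨n, hkn'⟩

end Order

/-! ### Alternating words -/

section Alternating

variable {B W : Type*} [Group W] {M : CoxeterMatrix B} (cs : CoxeterSystem M W)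

/-- The word of length `n` that alternates between `i` and `j`, beginning with `i`. -/
def altFrom (i j : B) : ℕ → List B
  | 0 => []
  | n + 1 => i :: altFrom j i n

@[simp]
theorem length_altFrom (i j : B) (n : ℕ) : (altFrom i j n).length = n := by
  induction n generalizing i j with
  | zero => rfl
  | succ n ih => simp [altFrom, ih]

/-- `alternatingWord` has a fixed last letter, whereas left descents and left inversions call for a
fixed first letter; the parity of `n` converts one into the other. -/
theorem alternatingWord_eq_altFrom (i j : B) (n : ℕ) :
    alternatingWord i j n = if Even n then altFrom i j n else altFrom j i n := by
  induction n with
  | zero => rfl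
  | succ n ih =>
    rw [alternatingWord_succ', ih]
    by_cases hn : Even n <;> simp [hn, Nat.even_add_one, altFrom]

theorem prod_map_altFrom_two_mul {G : Type*} [Monoid G] (f : B → G) (i j : B) (n : ℕ) :
    ((altFrom i j (2 * n)).map f).prod = (f i * f j) ^ n := by
  induction n with
  | zero => simp [altFrom]
  | succ n ih => simp [Nat.mul_succ, altFrom, ih, pow_succ', mul_assoc]

theorem prod_map_altFrom_eq {G : Type*} [Monoid G] {f : B → G} {i j : B}
    (h : ((braidWord M i j).map f).prod = ((braidWord M j i).map f).prod) :
    ((altFrom i j (M i j)).map f).prod = ((altFrom j i (M i j)).map f).prod := by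
  rw [braidWord, braidWord, M.symmetric j i, alternatingWord_eq_altFrom,
    alternatingWord_eq_altFrom] at h
  split_ifs at h
  · exact h
  · exact h.symm

theorem wordProd_altFrom_eq (i j : B) :
    cs.wordProd (altFrom i j (M i j)) = cs.wordProd (altFrom j i (M i j)) :=
  prod_map_altFrom_eq (cs.wordProd_braidWord_eq i j)

theorem leftInvSeq_altFrom (i j : B) (n : ℕ) :
    cs.leftInvSeq (altFrom i j n) =
      (List.range n).map fun k => (cs.simple i * cs.simple j) ^ k * cs.simple i := by
  induction n generalizing i j with
  | zero => rfl
  | succ n ih =>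
    rw [altFrom, leftInvSeq, ih, List.range_succ_eq_map]
    simp only [List.map_cons, List.map_map, pow_zero, one_mul, List.cons.injEq, true_and]
    refine List.map_congr_left fun k _ => ?_
    have h := (SemiconjBy.pow_right (a := cs.simple i) (x := cs.simple j * cs.simple i)
      (y := cs.simple i * cs.simple j) (by simp [SemiconjBy, mul_assoc]) k).eq
    simp only [Function.comp_apply, MulAut.conj_apply, inv_simple]
    rw [← mul_assoc, h, pow_succ]
    simp only [mul_assoc]

theorem leftInvSeq_append (ω ω' : List B) :
    cs.leftInvSeq (ω ++ ω') =
      cs.leftInvSeq ω ++ (cs.leftInvSeq ω').map (MulAut.conj (cs.wordProd ω)) := by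
  induction ω with
  | nil => simp
  | cons i ω ih =>
    simp [leftInvSeq, ih, wordProd_cons, Function.comp_def]

end Alternating

/-! ### The exchange condition -/

section Exchange

variable {B W : Type*} [Group W] {M : CoxeterMatrix B} (cs : CoxeterSystem M W)

open Classical in
/-- The operator on `W × ZMod 2` that conjugates the first component by `sᵢ` and changes the second
one if the first is `sᵢ`. -/
def conjFlip (i : B) : (Function.End (W × ZMod 2))ᵐᵒᵖ :=
  MulOpposite.op fun p =>
    (cs.simple i * p.1 * cs.simple i, p.2 + if p.1 = cs.simple i then 1 else 0)

-- Passing to the opposite monoid lets the first letter act first. The reflections at which the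
-- flips occur, conjugated back to the start, are then exactly the entries of the left inversion
-- sequence.
open Classical in
theorem prod_map_conjFlip (ω : List B) (p : W × ZMod 2) :
    ((ω.map (conjFlip cs)).prod.unop : W × ZMod 2 → W × ZMod 2) p =
      ((cs.wordProd ω)⁻¹ * p.1 * cs.wordProd ω, p.2 + ((cs.leftInvSeq ω).count p.1 : ZMod 2)) := by
  induction ω generalizing p with
  | nil => simp; rfl
  | cons i ω ih =>
    rw [List.map_cons, List.prod_cons, MulOpposite.unop_mul]
    change ((ω.map (conjFlip cs)).prod.unop : W × ZMod 2 → W × ZMod 2)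
      (cs.simple i * p.1 * cs.simple i, p.2 + if p.1 = cs.simple i then 1 else 0) = _
    rw [ih]
    have hcount : ((cs.leftInvSeq ω).map (MulAut.conj (cs.simple i))).count p.1 =
        (cs.leftInvSeq ω).count (cs.simple i * p.1 * cs.simple i) := by
      have h := List.count_map_of_injective (cs.leftInvSeq ω) (MulAut.conj (cs.simple i))
        (MulAut.conj (cs.simple i)).injective (cs.simple i * p.1 * cs.simple i)
      rw [← h]
      simp [mul_assoc]
    simp only [leftInvSeq, List.count_cons, wordProd_cons,
      mul_inv_rev, inv_simple, mul_assoc, hcount, Prod.mk.injEq, true_and, beq_iff_eq,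
      eq_comm (a := cs.simple i)]
    push_cast
    ring

/-- The entries `(s_i s_j)^k s_i`, `k < 2m`, are periodic in `k` with period `m`, so each value
occurs an even number of times and all flips cancel. -/
theorem conjFlip_isLiftable : M.IsLiftable (conjFlip cs) := by
  classical
  intro i j
  rw [← prod_map_altFrom_two_mul]
  apply MulOpposite.unop_injective
  funext p
  rw [prod_map_conjFlip]
  have hprod : cs.wordProd (altFrom i j (2 * M i j)) = 1 := by
    rw [wordProd, prod_map_altFrom_two_mul, simple_mul_simple_pow]
  have hcount : (((cs.leftInvSeq (altFrom i j (2 * M i j))).count p.1 : ℕ) : ZMod 2) = 0 := by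
    rw [leftInvSeq_altFrom, two_mul, List.range_add, List.map_append, List.count_append,
      List.map_map]
    have : ((fun k => (cs.simple i * cs.simple j) ^ k * cs.simple i) ∘ fun x => M i j + x) =
        fun k => (cs.simple i * cs.simple j) ^ k * cs.simple i := by
      funext k
      simp [pow_add]
    rw [this]
    push_cast
    exact CharTwo.add_self_eq_zero _
  rw [hprod, hcount]
  simp
  rfl

open Classical in
/-- The parity of the multiplicity of `t` in the left inversion sequence of a word depends only on
the product of the word. -/
theorem count_leftInvSeq_eq_of_wordProd_eq {ω ω' : List B} (h : cs.wordProd ω = cs.wordProd ω')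
    (t : W) :
    ((cs.leftInvSeq ω).count t : ZMod 2) = ((cs.leftInvSeq ω').count t : ZMod 2) := by
  have hlift (ω : List B) :
      cs.lift ⟨conjFlip cs, conjFlip_isLiftable cs⟩ (cs.wordProd ω) =
        (ω.map (conjFlip cs)).prod := by
    rw [wordProd, map_list_prod, List.map_map]
    congr 1
    refine List.map_congr_left fun i _ => ?_
    exact cs.lift_apply_simple (conjFlip_isLiftable cs) i
  have h1 : (ω.map (conjFlip cs)).prod = (ω'.map (conjFlip cs)).prod := by
    rw [← hlift, ← hlift, h]
  have h2 : ((ω.map (conjFlip cs)).prod.unop : W × ZMod 2 → W × ZMod 2) (t, 0) =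
      ((ω'.map (conjFlip cs)).prod.unop : W × ZMod 2 → W × ZMod 2) (t, 0) := by rw [h1]
  rw [prod_map_conjFlip, prod_map_conjFlip] at h2
  simpa using congrArg Prod.snd h2

/-- The exchange condition. -/
theorem simple_mem_leftInvSeq_of_isLeftDescent {ω : List B} {i : B}
    (h : cs.IsLeftDescent (cs.wordProd ω) i) : cs.simple i ∈ cs.leftInvSeq ω := by
  classical
  obtain ⟨ω', hω', hprod⟩ := cs.exists_isReduced (cs.simple i * cs.wordProd ω)
  have hnot : cs.simple i ∉ cs.leftInvSeq ω' := fun hmem => by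
    have h' := (cs.isLeftInversion_of_mem_leftInvSeq hω' hmem).2
    rw [← hprod, simple_mul_simple_cancel_left] at h'
    exact lt_asymm h h'
  -- The word `i :: ω'` spells the same element and has `s_i` exactly once in its inversion
  -- sequence, so by parity `s_i` occurs in that of `ω`.
  have heq : cs.wordProd ω = cs.wordProd (i :: ω') := by
    rw [wordProd_cons, ← hprod, simple_mul_simple_cancel_left]
  have hpar := count_leftInvSeq_eq_of_wordProd_eq cs heq (cs.simple i)
  have hnot' : cs.simple i ∉ (cs.leftInvSeq ω').map (MulAut.conj (cs.simple i)) := by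
    rw [List.mem_map]
    rintro ⟨t, ht, hti⟩
    have : t = cs.simple i := by
      apply (MulAut.conj (cs.simple i)).injective
      rw [hti]; simp
    exact hnot (this ▸ ht)
  rw [leftInvSeq, List.count_cons_self, List.count_eq_zero_of_not_mem hnot'] at hpar
  by_contra hc
  rw [List.count_eq_zero_of_not_mem hc] at hpar
  simp at hpar

/-- Each entry has odd multiplicity, so it occurs for every other word of the same element, in
particular for a reduced one, which therefore cannot be shorter. -/
theorem isReduced_of_nodup_leftInvSeq {ω : List B} (h : (cs.leftInvSeq ω).Nodup) :
    cs.IsReduced ω := by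
  classical
  obtain ⟨ω', hω', hprod⟩ := cs.exists_isReduced (cs.wordProd ω)
  have hsub : cs.leftInvSeq ω ⊆ cs.leftInvSeq ω' := by
    intro t ht
    have hpar := count_leftInvSeq_eq_of_wordProd_eq cs hprod t
    rw [List.count_eq_one_of_mem h ht] at hpar
    by_contra hc
    rw [List.count_eq_zero_of_not_mem hc] at hpar
    simp at hpar
  have hle := (List.Nodup.subperm h hsub).length_le
  rw [length_leftInvSeq, length_leftInvSeq] at hle
  have h1 : cs.length (cs.wordProd ω) = ω'.length := by rw [hprod]; exact hω'
  exact le_antisymm (cs.length_wordProd_le ω) (h1 ▸ hle)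

/-- The inversions `(s_i s_j)^k s_i`, `k < n`, are distinct because the order of `s_i s_j` is not
smaller than `m_ij`. -/
theorem isReduced_altFrom {i j : B} (hij : i ≠ j) {n : ℕ} (hn : M i j = 0 ∨ n ≤ M i j) :
    cs.IsReduced (altFrom i j n) := by
  refine isReduced_of_nodup_leftInvSeq cs ?_
  rw [leftInvSeq_altFrom]
  refine List.Nodup.map_on ?_ List.nodup_range
  have aux : ∀ a b : ℕ, a ≤ b → b < n →
      (cs.simple i * cs.simple j) ^ a * cs.simple i =
        (cs.simple i * cs.simple j) ^ b * cs.simple i → a = b := by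
    intro a b hab hb h
    obtain ⟨d, rfl⟩ := Nat.exists_eq_add_of_le hab
    have h' := mul_right_cancel h
    rw [pow_add, left_eq_mul] at h'
    have hd := dvd_of_simple_mul_simple_pow_eq_one cs hij h'
    have hd0 : d = 0 := by
      rcases hn with h0 | hle
      · rwa [h0, zero_dvd_iff] at hd
      · exact Nat.eq_zero_of_dvd_of_lt hd (by omega)
    omega
  intro a ha b hb h
  rw [List.mem_range] at ha hb
  rcases le_total a b with hab | hab
  · exact aux a b hab hb h
  · exact (aux b a hab ha h.symm).symm

/-- By exchange, `s_i` is an inversion of a reduced word of `w` followed by `j`. It does not come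
from `w`, so it is the last entry, `w s_j w⁻¹`. -/
theorem simple_mul_eq_mul_simple {w : W} {i j : B} (hi : ¬cs.IsLeftDescent w i)
    (h : cs.IsLeftDescent (w * cs.simple j) i) : cs.simple i * w = w * cs.simple j := by
  obtain ⟨ω, hω, rfl⟩ := cs.exists_isReduced w
  have hw : cs.wordProd ω * cs.simple j = cs.wordProd (ω ++ [j]) := by simp [wordProd_append]
  rw [hw] at h
  have hmem := simple_mem_leftInvSeq_of_isLeftDescent cs h
  rw [leftInvSeq_append, List.mem_append] at hmem
  rcases hmem with hmem | hmem
  · exact absurd (cs.isLeftInversion_of_mem_leftInvSeq hω hmem).2 hi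
  · simp only [leftInvSeq_singleton, List.map_cons, List.map_nil, List.mem_singleton,
      MulAut.conj_apply] at hmem
    rw [hmem]
    simp

end Exchange

/-! ### Reduced words and braid relations -/

section Matsumoto

variable {B W : Type*} [Group W] {M : CoxeterMatrix B} (cs : CoxeterSystem M W)

/-- An element with two distinct left descents `i` and `j` has a reduced expression beginning with
any reduced alternating word in `i` and `j`. -/
theorem exists_eq_wordProd_altFrom_mul {w : W} {i j : B} (hij : i ≠ j)
    (hi : cs.IsLeftDescent w i) (hj : cs.IsLeftDescent w j) (n : ℕ)
    (hn : M i j = 0 ∨ n ≤ M i j) :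
    ∃ v : W, w = cs.wordProd (altFrom i j n) * v ∧ cs.length w = n + cs.length v := by
  induction n generalizing i j with
  | zero => exact ⟨w, by simp [altFrom], by simp⟩
  | succ n ih =>
    obtain ⟨v, hv, hlen⟩ := ih hij.symm hj hi (by rw [M.symmetric j i]; omega)
    obtain ⟨ν, hν, rfl⟩ := cs.exists_isReduced v
    have hmem : cs.simple i ∈ cs.leftInvSeq (altFrom j i n ++ ν) := by
      apply simple_mem_leftInvSeq_of_isLeftDescent
      rwa [wordProd_append, ← hv]
    rw [leftInvSeq_append, List.mem_append] at hmem
    have hred : cs.IsReduced (altFrom j i n) :=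
      isReduced_altFrom cs hij.symm (by rw [M.symmetric j i]; omega)
    have hred' := isReduced_altFrom cs hij hn
    -- Exchange deletes a letter either in the alternating prefix or in `ν`. The first would make
    -- the longer alternating word non-reduced; in the second, `r * wordProd ν` is the shortened
    -- remainder.
    rcases hmem with hmem | hmem
    · have h := (cs.isLeftInversion_of_mem_leftInvSeq hred hmem).2
      rw [← wordProd_cons, hred.eq] at h
      change cs.length (cs.wordProd (altFrom i j (n + 1))) < _ at h
      rw [hred'.eq] at h
      simp at h
    · obtain ⟨r, hr, hri⟩ := List.mem_map.mp hmem
      have hr' := (cs.isLeftInversion_of_mem_leftInvSeq hν hr)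
      have hrr := hr'.1.mul_self
      have hw : w = cs.wordProd (altFrom i j (n + 1)) * (r * cs.wordProd ν) := by
        rw [altFrom, wordProd_cons, ← hri, hv, MulAut.conj_apply]
        simp only [mul_assoc, inv_mul_cancel_left]
        rw [← mul_assoc r r, hrr, one_mul]
      refine ⟨r * cs.wordProd ν, hw, le_antisymm ?_ ?_⟩
      · conv_lhs => rw [hw]
        refine (cs.length_mul_le _ _).trans ?_
        rw [hred'.eq, length_altFrom]
      · have := hr'.2
        omega

/-- Two reduced words with the same product have the same image under any map to a monoid that
satisfies the braid relations. -/
theorem prod_map_eq_of_isReduced {G : Type*} [Monoid G] {f : B → G}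
    (hf : ∀ i j, ((braidWord M i j).map f).prod = ((braidWord M j i).map f).prod)
    {ω ω' : List B} (hω : cs.IsReduced ω) (hω' : cs.IsReduced ω')
    (h : cs.wordProd ω = cs.wordProd ω') : (ω.map f).prod = (ω'.map f).prod := by
  have hlen {ω ω' : List B} (hω : cs.IsReduced ω) (hω' : cs.IsReduced ω')
      (h : cs.wordProd ω = cs.wordProd ω') : ω.length = ω'.length := by
    rw [← hω.eq, ← hω'.eq, h]
  generalize hn : ω.length = n
  induction n generalizing ω ω' with
  | zero =>
    rw [List.length_eq_zero_iff.mp hn,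
      List.length_eq_zero_iff.mp ((hlen hω hω' h).symm.trans hn)]
  | succ n ih =>
    have hn' := (hlen hω hω' h).symm.trans hn
    obtain ⟨i, α, rfl⟩ := List.exists_cons_of_length_eq_add_one hn
    obtain ⟨j, β, rfl⟩ := List.exists_cons_of_length_eq_add_one hn'
    have hα : cs.IsReduced α := hω.drop 1
    have hβ : cs.IsReduced β := hω'.drop 1
    simp only [List.length_cons, Nat.add_right_cancel_iff] at hn hn'
    have hdesc {i : B} {α : List B} (hω : cs.IsReduced (i :: α)) (hα : cs.IsReduced α) :
        cs.IsLeftDescent (cs.wordProd (i :: α)) i := by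
      rw [isLeftDescent_iff, hω.eq, wordProd_cons, simple_mul_simple_cancel_left, hα.eq,
        List.length_cons]
    by_cases hij : i = j
    · subst hij
      rw [wordProd_cons, wordProd_cons] at h
      simp only [List.map_cons, List.prod_cons]
      rw [ih hα hβ (mul_left_cancel h) hn]
    have hi := hdesc hω hα
    have hj := hdesc hω' hβ
    rw [← h] at hj
    -- If `m_ij = ∞`, the element would have alternating prefixes longer than itself.
    have hM : M i j ≠ 0 := by
      intro h0
      obtain ⟨v, -, hv⟩ := exists_eq_wordProd_altFrom_mul cs hij hi hj
        (cs.length (cs.wordProd (i :: α)) + 1) (Or.inl h0)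
      omega
    obtain ⟨v, hv, hvlen⟩ := exists_eq_wordProd_altFrom_mul cs hij hi hj (M i j) (Or.inr le_rfl)
    obtain ⟨ν, hν, rfl⟩ := cs.exists_isReduced v
    obtain ⟨m, hm⟩ := Nat.exists_eq_succ_of_ne_zero hM
    rw [hω.eq, hν.eq, List.length_cons, hn, hm] at hvlen
    -- Both words are compared with words `altFrom _ _ (m + 1) ++ ν` having the same first letter,
    -- to which induction applies after cancelling it. These two differ by one braid relation.
    have step {i j : B} {α : List B} (hα : cs.IsReduced α) (hn : α.length = n)
        (hv : cs.wordProd (i :: α) = cs.wordProd (altFrom i j (m + 1)) * cs.wordProd ν) :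
        ((i :: α).map f).prod = ((altFrom i j (m + 1)).map f).prod * (ν.map f).prod := by
      have heq : cs.wordProd α = cs.wordProd (altFrom j i m ++ ν) := by
        rw [altFrom, wordProd_cons, wordProd_cons, mul_assoc] at hv
        rw [wordProd_append]
        exact mul_left_cancel hv
      have hred : cs.IsReduced (altFrom j i m ++ ν) := by
        rw [CoxeterSystem.IsReduced, ← heq, hα.eq, List.length_append, length_altFrom]
        omega
      rw [List.map_cons, List.prod_cons, ih hα hred heq hn, altFrom]
      simp [mul_assoc]
    have hb := prod_map_altFrom_eq (hf i j)
    have hb' := wordProd_altFrom_eq cs i j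
    rw [hm] at hb hb' hv
    rw [step hα hn hv, hb, step hβ hn' (by rw [← h, hv, hb'])]

end Matsumoto

/-! ### Left and right multiplication operators on the free module over `W` -/

namespace MarinDatum

section Regular

variable {B W : Type*} [Group W] {M : CoxeterMatrix B} {cs : CoxeterSystem M W}
  {k A : Type*} [CommRing k] [CommRing A] [Algebra k A] (D : MarinDatum cs k A)

/-- The action of `W` on the coefficients. -/
def act (w : W) : D.Coeff ≃ₐ[k] D.Coeff :=
  (D.toCoeff.symm.trans (D.ρ w)).trans D.toCoeff

/-- The parameter `a_s` as a coefficient. -/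
def param (i : B) : D.Coeff := D.toCoeff (D.a i)

theorem smul_eq_act (x : ArtinGroup M) (c : D.Coeff) : x • c = D.act (artinProj cs x) c := rfl

theorem act_one (c : D.Coeff) : D.act 1 c = c := by simp [act]

theorem act_mul (w w' : W) (c : D.Coeff) : D.act (w * w') c = D.act w (D.act w' c) := by
  simp [act]

theorem act_simple_act_simple (i : B) (c : D.Coeff) :
    D.act (cs.simple i) (D.act (cs.simple i) c) = c := by
  rw [← act_mul, simple_mul_simple_self, act_one]

theorem act_param {w : W} {i j : B} (h : w * cs.simple i * w⁻¹ = cs.simple j) :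
    D.act w (D.param i) = D.param j := by
  have := congrArg (Units.val) (D.equivariant w i j h)
  simpa [act, param] using this

theorem act_simple_param (i : B) : D.act (cs.simple i) (D.param i) = D.param i :=
  D.act_param (by simp)

theorem isUnit_param (i : B) : IsUnit (D.param i) :=
  (D.a i).isUnit.map D.toCoeff

/-- The condition `(1 - a_s) (s.c) = (1 - a_s) c` on the coefficients `c`. -/
def IsCompatible : Prop :=
  ∀ (i : B) (c : D.Coeff), (1 - D.param i) * D.act (cs.simple i) c = (1 - D.param i) * c

open Classical in
/-- Left multiplication by `g_s` on the free module with basis `W`. -/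
def leftOp (i : B) : Module.End k (W →₀ D.Coeff) :=
  Finsupp.lsum k fun w =>
    (if cs.IsLeftDescent w i then
      (Finsupp.lsingle (cs.simple i * w)).comp (LinearMap.mulLeft k (D.param i)) +
        (Finsupp.lsingle w).comp (LinearMap.mulLeft k (1 - D.param i))
    else Finsupp.lsingle (cs.simple i * w)).comp (D.act (cs.simple i)).toLinearMap

open Classical in
/-- Right multiplication by `g_s` on the free module with basis `W`. -/
def rightOp (i : B) : Module.End k (W →₀ D.Coeff) :=
  Finsupp.lsum k fun w =>
    -- Coefficients are written on the left, so the parameter is carried across by `g_w a_s =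
    -- (w.a_s) g_w`.
    if cs.IsRightDescent w i then
      (Finsupp.lsingle (w * cs.simple i)).comp (LinearMap.mulLeft k (D.act w (D.param i))) +
        (Finsupp.lsingle w).comp (LinearMap.mulLeft k (1 - D.act w (D.param i)))
    else Finsupp.lsingle (w * cs.simple i)

variable {D}

theorem leftOp_single_of_isLeftDescent {w : W} {i : B} (h : cs.IsLeftDescent w i)
    (c : D.Coeff) :
    D.leftOp i (Finsupp.single w c) =
      Finsupp.single (cs.simple i * w) (D.param i * D.act (cs.simple i) c) +
        Finsupp.single w ((1 - D.param i) * D.act (cs.simple i) c) := by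
  simp [leftOp, h]

theorem leftOp_single_of_not_isLeftDescent {w : W} {i : B} (h : ¬cs.IsLeftDescent w i)
    (c : D.Coeff) :
    D.leftOp i (Finsupp.single w c) =
      Finsupp.single (cs.simple i * w) (D.act (cs.simple i) c) := by
  simp [leftOp, h]

theorem rightOp_single_of_isRightDescent {w : W} {i : B} (h : cs.IsRightDescent w i)
    (c : D.Coeff) :
    D.rightOp i (Finsupp.single w c) =
      Finsupp.single (w * cs.simple i) (D.act w (D.param i) * c) +
        Finsupp.single w ((1 - D.act w (D.param i)) * c) := by
  simp [rightOp, h]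

theorem rightOp_single_of_not_isRightDescent {w : W} {i : B} (h : ¬cs.IsRightDescent w i)
    (c : D.Coeff) :
    D.rightOp i (Finsupp.single w c) = Finsupp.single (w * cs.simple i) c := by
  simp [rightOp, h]

theorem leftOp_smul (i : B) (c : D.Coeff) (x : W →₀ D.Coeff) :
    D.leftOp i (c • x) = D.act (cs.simple i) c • D.leftOp i x := by
  induction x using Finsupp.induction_linear with
  | zero => simp
  | add x y hx hy => rw [smul_add, map_add, map_add, hx, hy, smul_add]
  | single w d =>
    rw [Finsupp.smul_single, smul_eq_mul]
    by_cases h : cs.IsLeftDescent w i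
    · rw [leftOp_single_of_isLeftDescent h, leftOp_single_of_isLeftDescent h, smul_add,
        Finsupp.smul_single, Finsupp.smul_single, map_mul, smul_eq_mul, smul_eq_mul,
        mul_left_comm, mul_left_comm (1 - _)]
    · rw [leftOp_single_of_not_isLeftDescent h, leftOp_single_of_not_isLeftDescent h,
        Finsupp.smul_single, map_mul, smul_eq_mul]

/-- The square of `leftOp i` restores the coefficient `c`, while the right side has `(1 - a_s)(s.c)`
in front of the linear term; compatibility identifies the two. -/
theorem leftOp_leftOp (hD : D.IsCompatible) (i : B) (x : W →₀ D.Coeff) :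
    D.leftOp i (D.leftOp i x) = D.param i • x + (1 - D.param i) • D.leftOp i x := by
  induction x using Finsupp.induction_linear with
  | zero => simp
  | add x y hx hy => simp only [map_add, smul_add, hx, hy]; abel
  | single w c =>
    by_cases h : cs.IsLeftDescent w i
    · have h' : ¬cs.IsLeftDescent (cs.simple i * w) i := by
        rw [IsLeftDescent, simple_mul_simple_cancel_left]; exact lt_asymm h
      rw [leftOp_single_of_isLeftDescent h, map_add, leftOp_single_of_not_isLeftDescent h',
        leftOp_single_of_isLeftDescent h]
      simp only [simple_mul_simple_cancel_left, map_mul, map_sub, map_one, act_simple_param,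
        act_simple_act_simple, smul_add, Finsupp.smul_single, smul_eq_mul]
      rw [mul_left_comm (1 - D.param i) (D.param i) (D.act (cs.simple i) c), hD i c]
    · have h' : cs.IsLeftDescent (cs.simple i * w) i := by
        rw [IsLeftDescent, simple_mul_simple_cancel_left]
        have := cs.not_isLeftDescent_iff.mp h
        omega
      rw [leftOp_single_of_not_isLeftDescent h, leftOp_single_of_isLeftDescent h']
      simp only [simple_mul_simple_cancel_left, act_simple_act_simple, Finsupp.smul_single,
        smul_eq_mul]
      rw [hD i c]

theorem act_param_of_simple_mul_eq {w : W} {i j : B} (h : cs.simple i * w = w * cs.simple j) :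
    D.act w (D.param j) = D.param i := D.act_param (by rw [← h]; simp)

/-- The lengths of `w`, `s_i w`, `w s_j` and `s_i w s_j` decide which formulas apply. The critical
cases are those where `s_i` and `s_j` both lengthen or both shorten `w` but `s_i w s_j` has the
length of `w`. Then `s_i w = w s_j`, and equivariance gives `w.a_j = a_i`. -/
theorem leftOp_rightOp (hD : D.IsCompatible) (i j : B) (x : W →₀ D.Coeff) :
    D.leftOp i (D.rightOp j x) = D.rightOp j (D.leftOp i x) := by
  induction x using Finsupp.induction_linear with
  | zero => simp
  | add x y hx hy => simp only [map_add, hx, hy]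
  | single w c =>
    have l1 := cs.length_simple_mul w i
    have l2 := cs.length_mul_simple w j
    have l3 := cs.length_simple_mul (w * cs.simple j) i
    have l4 := cs.length_mul_simple (cs.simple i * w) j
    rw [← mul_assoc] at l3
    by_cases hl : cs.IsLeftDescent w i <;> by_cases hr : cs.IsRightDescent w j
    · have hl0 := cs.isLeftDescent_iff.mp hl
      have hr0 := cs.isRightDescent_iff.mp hr
      by_cases hlr : cs.IsRightDescent (cs.simple i * w) j
      · have hlr' : cs.IsLeftDescent (w * cs.simple j) i := by
          rw [IsLeftDescent, ← mul_assoc]; rw [IsRightDescent] at hlr; omega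
        rw [rightOp_single_of_isRightDescent hr, leftOp_single_of_isLeftDescent hl, map_add,
          map_add, leftOp_single_of_isLeftDescent hlr', leftOp_single_of_isLeftDescent hl,
          rightOp_single_of_isRightDescent hlr, rightOp_single_of_isRightDescent hr]
        -- One side carries `w.a_j` and the other `s_i w.a_j`; in the terms where they differ, the
        -- factor `1 - a_i` absorbs the difference.
        have e := hD i (D.act w (D.param j))
        simp only [map_mul, map_sub, map_one, act_mul, ← mul_assoc (cs.simple i)]
        rw [show (1 - D.param i) * (D.act (cs.simple i) (D.act w (D.param j)) *
            D.act (cs.simple i) c) =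
          D.act w (D.param j) * ((1 - D.param i) * D.act (cs.simple i) c) by
            linear_combination D.act (cs.simple i) c * e,
          show (1 - D.param i) * ((1 - D.act (cs.simple i) (D.act w (D.param j))) *
            D.act (cs.simple i) c) =
          (1 - D.act w (D.param j)) * ((1 - D.param i) * D.act (cs.simple i) c) by
            linear_combination - D.act (cs.simple i) c * e,
          mul_left_comm (D.param i), mul_left_comm (D.param i) (1 - _)]
        abel
      · have hlr' : ¬cs.IsLeftDescent (w * cs.simple j) i := by
          rw [IsLeftDescent, ← mul_assoc]; rw [IsRightDescent] at hlr; omega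
        have hcomm : cs.simple i * w = w * cs.simple j := by
          have h1 : ¬cs.IsLeftDescent (cs.simple i * w) i := by
            rw [IsLeftDescent, simple_mul_simple_cancel_left]; omega
          have h2 : cs.IsLeftDescent (cs.simple i * w * cs.simple j) i := by
            rw [IsLeftDescent, mul_assoc, simple_mul_simple_cancel_left, ← mul_assoc]
            rw [IsRightDescent] at hlr; omega
          have := simple_mul_eq_mul_simple cs h1 h2
          rw [simple_mul_simple_cancel_left] at this
          conv_rhs => rw [this]
          simp
        have hp := act_param_of_simple_mul_eq (D := D) hcomm
        rw [rightOp_single_of_isRightDescent hr, leftOp_single_of_isLeftDescent hl, map_add,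
          map_add, leftOp_single_of_not_isLeftDescent hlr', leftOp_single_of_isLeftDescent hl,
          rightOp_single_of_not_isRightDescent hlr, rightOp_single_of_isRightDescent hr]
        simp only [map_mul, map_sub, map_one, hp, act_simple_param, ← hcomm,
          simple_mul_simple_cancel_left]
        rw [show cs.simple i * w * cs.simple j = w by rw [hcomm]; simp,
          mul_left_comm (D.param i)]
    · have hl0 := cs.isLeftDescent_iff.mp hl
      have hr0 := cs.not_isRightDescent_iff.mp hr
      have h1 : cs.IsLeftDescent (w * cs.simple j) i := by
        rw [IsLeftDescent, ← mul_assoc]; omega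
      have h2 : ¬cs.IsRightDescent (cs.simple i * w) j := by
        rw [IsRightDescent]; omega
      rw [rightOp_single_of_not_isRightDescent hr, leftOp_single_of_isLeftDescent hl, map_add,
        leftOp_single_of_isLeftDescent h1, rightOp_single_of_not_isRightDescent h2,
        rightOp_single_of_not_isRightDescent hr, mul_assoc]
    · have hl0 := cs.not_isLeftDescent_iff.mp hl
      have hr0 := cs.isRightDescent_iff.mp hr
      have h1 : ¬cs.IsLeftDescent (w * cs.simple j) i := by
        rw [IsLeftDescent, ← mul_assoc]; omega
      have h2 : cs.IsRightDescent (cs.simple i * w) j := by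
        rw [IsRightDescent]; omega
      rw [rightOp_single_of_isRightDescent hr, leftOp_single_of_not_isLeftDescent hl, map_add,
        leftOp_single_of_not_isLeftDescent h1, rightOp_single_of_isRightDescent h2,
        leftOp_single_of_not_isLeftDescent hl, mul_assoc]
      simp only [map_mul, map_sub, map_one, act_mul]
    · have hl0 := cs.not_isLeftDescent_iff.mp hl
      have hr0 := cs.not_isRightDescent_iff.mp hr
      rw [rightOp_single_of_not_isRightDescent hr, leftOp_single_of_not_isLeftDescent hl]
      by_cases hlr : cs.IsRightDescent (cs.simple i * w) j
      · have hlr' : cs.IsLeftDescent (w * cs.simple j) i := by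
          rw [IsLeftDescent, ← mul_assoc]; rw [IsRightDescent] at hlr; omega
        have hcomm := simple_mul_eq_mul_simple cs hl hlr'
        have hp := act_param_of_simple_mul_eq (D := D) hcomm
        rw [rightOp_single_of_isRightDescent hlr, leftOp_single_of_isLeftDescent hlr']
        simp only [act_mul, hp, act_simple_param, ← hcomm, mul_assoc]
      · have hlr' : ¬cs.IsLeftDescent (w * cs.simple j) i := by
          rw [IsLeftDescent, ← mul_assoc]; rw [IsRightDescent] at hlr; omega
        rw [rightOp_single_of_not_isRightDescent hlr, leftOp_single_of_not_isLeftDescent hlr',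
          mul_assoc]

theorem prod_leftOp_smul (ω : List B) (c : D.Coeff) (x : W →₀ D.Coeff) :
    (ω.map D.leftOp).prod (c • x) = D.act (cs.wordProd ω) c • (ω.map D.leftOp).prod x := by
  induction ω with
  | nil => simp [act_one]
  | cons i ω ih => simp [ih, leftOp_smul, wordProd_cons, act_mul]

theorem prod_leftOp_rightOp (hD : D.IsCompatible) (ω : List B) (j : B) (x : W →₀ D.Coeff) :
    (ω.map D.leftOp).prod (D.rightOp j x) = D.rightOp j ((ω.map D.leftOp).prod x) := by
  induction ω with
  | nil => simp
  | cons i ω ih => simp [ih, leftOp_rightOp hD]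

theorem prod_leftOp_single_one {ω : List B} (hω : cs.IsReduced ω) :
    (ω.map D.leftOp).prod (Finsupp.single 1 1) = Finsupp.single (cs.wordProd ω) 1 := by
  induction ω with
  | nil => simp
  | cons i ω ih =>
    have hred : cs.IsReduced ω := hω.drop 1
    have h : ¬cs.IsLeftDescent (cs.wordProd ω) i := by
      rw [not_isLeftDescent_iff, ← wordProd_cons, hω.eq, hred.eq, List.length_cons]
    rw [List.map_cons, List.prod_cons, Module.End.mul_apply, ih hred,
      leftOp_single_of_not_isLeftDescent h, map_one, wordProd_cons]

/-- Two products of operators `leftOp` over words with the same product in `W` are equal if they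
agree on the basis vector `1`. -/
theorem prod_leftOp_ext (hD : D.IsCompatible) {ω ω' : List B}
    (h : cs.wordProd ω = cs.wordProd ω')
    (h1 : (ω.map D.leftOp).prod (Finsupp.single 1 1) =
      (ω'.map D.leftOp).prod (Finsupp.single 1 1)) :
    (ω.map D.leftOp).prod = (ω'.map D.leftOp).prod := by
  have hw (w : W) : (ω.map D.leftOp).prod (Finsupp.single w 1) =
      (ω'.map D.leftOp).prod (Finsupp.single w 1) := by
    obtain ⟨ν, hν, rfl⟩ := cs.exists_isReduced w
    induction ν using List.reverseRecOn with
    | nil => simpa using h1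
    | append_singleton ν j ih =>
      have hred : cs.IsReduced ν := by simpa using hν.take ν.length
      have hd : ¬cs.IsRightDescent (cs.wordProd ν) j := by
        rw [not_isRightDescent_iff, ← wordProd_concat, List.concat_eq_append, hν.eq, hred.eq,
          List.length_append, List.length_singleton]
      -- Right operators along a reduced word carry the basis vector `1` to any basis vector, and
      -- they commute with all left operators.
      have hs : Finsupp.single (cs.wordProd (ν ++ [j])) 1 =
          D.rightOp j (Finsupp.single (cs.wordProd ν) 1) := by
        rw [rightOp_single_of_not_isRightDescent hd, ← wordProd_concat, List.concat_eq_append]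
      rw [hs, prod_leftOp_rightOp hD, prod_leftOp_rightOp hD, ih hred]
  refine Finsupp.lhom_ext fun w c => ?_
  -- Both products are semilinear for the same twist, since the words have the same product in `W`.
  have hc : Finsupp.single w c = c • Finsupp.single w (1 : D.Coeff) := by simp
  rw [hc, prod_leftOp_smul, prod_leftOp_smul, hw, h]

/-- Both braid words are reduced, so each sends the basis vector `1` to the basis vector of their
common product. -/
theorem prod_leftOp_braidWord (hD : D.IsCompatible) (i j : B) :
    ((braidWord M i j).map D.leftOp).prod = ((braidWord M j i).map D.leftOp).prod := by
  by_cases hij : i = j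
  · rw [hij]
  have hred (i j : B) (hij : i ≠ j) : cs.IsReduced (braidWord M i j) := by
    rw [braidWord, alternatingWord_eq_altFrom]
    split_ifs
    · exact isReduced_altFrom cs hij (Or.inr le_rfl)
    · exact isReduced_altFrom cs (Ne.symm hij) (Or.inr (M.symmetric i j).le)
  refine prod_leftOp_ext hD (cs.wordProd_braidWord_eq i j) ?_
  rw [prod_leftOp_single_one (hred i j hij), prod_leftOp_single_one (hred j i (Ne.symm hij)),
    cs.wordProd_braidWord_eq]

end Regular

end MarinDatum

/-! ### Positive lifts to the Artin group -/

theorem artinWord_cons {B : Type*} (M : CoxeterMatrix B) (i : B) (ω : List B) :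
    artinWord M (i :: ω) = PresentedGroup.of i * artinWord M ω := by
  simp [artinWord]

theorem prod_map_of_braidWord {B : Type*} (M : CoxeterMatrix B) (i j : B) :
    ((braidWord M i j).map fun i => (PresentedGroup.of i : ArtinGroup M)).prod =
      ((braidWord M j i).map fun i => (PresentedGroup.of i : ArtinGroup M)).prod := by
  have h : (PresentedGroup.mk (artinRelations M)
      (((braidWord M i j).map FreeGroup.of).prod *
        (((braidWord M j i).map FreeGroup.of).prod)⁻¹)) = 1 :=
    PresentedGroup.one_of_mem ⟨i, j, rfl⟩
  rw [map_mul, map_inv, mul_inv_eq_one, map_list_prod, map_list_prod, List.map_map,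
    List.map_map] at h
  exact h

/-- The positive lift to the Artin group of an element of the Coxeter group does not depend on the
reduced word. -/
theorem artinWord_eq_of_isReduced {B W : Type*} [Group W] {M : CoxeterMatrix B}
    (cs : CoxeterSystem M W) {ω ω' : List B} (hω : cs.IsReduced ω) (hω' : cs.IsReduced ω')
    (h : cs.wordProd ω = cs.wordProd ω') : artinWord M ω = artinWord M ω' :=
  prod_map_eq_of_isReduced cs (prod_map_of_braidWord M) hω hω' h

theorem artinProj_of {B W : Type*} [Group W] {M : CoxeterMatrix B} (cs : CoxeterSystem M W)
    (i : B) : artinProj cs (PresentedGroup.of i) = cs.simple i := by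
  simp [artinProj]

namespace MarinDatum

variable {B W : Type*} [Group W] {M : CoxeterMatrix B} {cs : CoxeterSystem M W}
  {k A : Type*} [CommRing k] [CommRing A] [Algebra k A] (D : MarinDatum cs k A)

/-! ### Computations in the Marin algebra -/

theorem coeff_smul_def (c : D.Coeff) (x : D.MarinAlgebra) : c • x = D.coeffHom c * x := rfl

theorem quotientMap_single (g : ArtinGroup M) (c : D.Coeff) :
    D.quotientMap (SkewMonoidAlgebra.single g c) = c • D.gen g := by
  rw [coeff_smul_def]
  change _ = D.quotientMap (SkewMonoidAlgebra.single 1 c) *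
    D.quotientMap (SkewMonoidAlgebra.single g 1)
  rw [← map_mul, SkewMonoidAlgebra.single_mul_single]
  simp

theorem quotientMap_surjective : Function.Surjective D.quotientMap :=
  RingQuot.mkAlgHom_surjective k D.Rel

theorem gen_mul_smul (g : ArtinGroup M) (c : D.Coeff) (x : D.MarinAlgebra) :
    D.gen g * c • x = D.act (artinProj cs g) c • (D.gen g * x) := by
  rw [coeff_smul_def, coeff_smul_def, ← mul_assoc, ← mul_assoc]
  congr 1
  change D.quotientMap (SkewMonoidAlgebra.single g 1) *
      D.quotientMap (SkewMonoidAlgebra.single 1 c) =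
    D.quotientMap (SkewMonoidAlgebra.single 1 _) * D.quotientMap (SkewMonoidAlgebra.single g 1)
  rw [← map_mul, ← map_mul, SkewMonoidAlgebra.single_mul_single,
    SkewMonoidAlgebra.single_mul_single]
  simp [smul_eq_act]

theorem gen_of_mul_gen_of_mul (i : B) (x : D.MarinAlgebra) :
    D.gen (PresentedGroup.of i) * (D.gen (PresentedGroup.of i) * x) =
      D.param i • x + (1 - D.param i) • (D.gen (PresentedGroup.of i) * x) := by
  have h := RingQuot.mkAlgHom_rel k (Rel.quadratic (D := D) i)
  change D.quotientMap _ = D.quotientMap _ at h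
  rw [map_pow, map_add, map_mul, quotientMap_single, quotientMap_single, quotientMap_single,
    one_smul, map_one, coeff_smul_def, coeff_smul_def, mul_one, mul_one] at h
  rw [← mul_assoc, ← sq, h, add_mul, mul_assoc]
  rfl

/-- The universal property of the Marin algebra. -/
def liftHom {C : Type*} [Ring C] [Algebra k C] (f : D.Coeff →ₐ[k] C) (g : ArtinGroup M →* C)
    (hcomm : ∀ x c, f (x • c) * g x = g x * f c)
    (hquad : ∀ i, g (PresentedGroup.of i) * g (PresentedGroup.of i) =
      f (D.param i) + f (1 - D.param i) * g (PresentedGroup.of i)) : D.MarinAlgebra →ₐ[k] C :=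
  RingQuot.liftAlgHom k ⟨SkewMonoidAlgebra.liftNCAlgHom f g (fun {c x} => hcomm x c), by
    rintro _ _ ⟨i⟩
    have h (x : ArtinGroup M) (c : D.Coeff) :
        SkewMonoidAlgebra.liftNCAlgHom f g (fun {c x} => hcomm x c)
          (SkewMonoidAlgebra.single x c) = f c * g x :=
      SkewMonoidAlgebra.liftNC_single _ _ _ _
    rw [map_pow, map_add, map_mul, h, h, h, map_one, map_one, one_mul, mul_one, mul_one, sq]
    exact hquad i⟩

section liftHom

variable {C : Type*} [Ring C] [Algebra k C] (f : D.Coeff →ₐ[k] C) (g : ArtinGroup M →* C)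
  (hcomm : ∀ x c, f (x • c) * g x = g x * f c)
  (hquad : ∀ i, g (PresentedGroup.of i) * g (PresentedGroup.of i) =
    f (D.param i) + f (1 - D.param i) * g (PresentedGroup.of i))

theorem liftHom_quotientMap_single (x : ArtinGroup M) (c : D.Coeff) :
    D.liftHom f g hcomm hquad (D.quotientMap (SkewMonoidAlgebra.single x c)) = f c * g x :=
  (RingQuot.liftAlgHom_mkAlgHom_apply k _ _ _).trans (SkewMonoidAlgebra.liftNC_single _ _ _ _)

theorem liftHom_coeffHom (c : D.Coeff) : D.liftHom f g hcomm hquad (D.coeffHom c) = f c := by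
  refine (liftHom_quotientMap_single D f g hcomm hquad 1 c).trans ?_
  rw [map_one, mul_one]

theorem liftHom_gen (x : ArtinGroup M) : D.liftHom f g hcomm hquad (D.gen x) = g x := by
  refine (liftHom_quotientMap_single D f g hcomm hquad x 1).trans ?_
  rw [map_one, one_mul]

end liftHom

/-! ### The regular representation -/

variable {D}

/-- Invertibility is needed for an action of the Artin group. The quadratic relation yields the
inverse `a_s⁻¹ (g_s - (1 - a_s))`. -/
theorem isUnit_leftOp (hD : D.IsCompatible) (i : B) : IsUnit (D.leftOp i) := by
  obtain ⟨b, hb⟩ := (D.isUnit_param i).exists_left_inv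
  have hb' : D.act (cs.simple i) b * D.param i = 1 := by
    rw [← D.act_simple_param i, ← map_mul, hb, map_one]
  rw [Module.End.isUnit_iff]
  constructor
  · rw [injective_iff_map_eq_zero]
    intro x hx
    have h := leftOp_leftOp hD i x
    rw [hx, map_zero, smul_zero, add_zero] at h
    rw [← one_smul D.Coeff x, ← hb, mul_smul, ← h, smul_zero]
  · intro y
    refine ⟨b • (D.leftOp i y - (1 - D.param i) • y), ?_⟩
    rw [leftOp_smul, map_sub, leftOp_smul, leftOp_leftOp hD, map_sub, map_one, act_simple_param,
      add_sub_cancel_right, smul_smul, hb', one_smul]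

/-- The action of the Artin group on the free module with basis `W`. -/
def artinRep (hD : D.IsCompatible) : ArtinGroup M →* Module.End k (W →₀ D.Coeff) :=
  (Units.coeHom _).comp (PresentedGroup.toGroup (f := fun i => (isUnit_leftOp hD i).unit) (by
    rintro _ ⟨i, j, rfl⟩
    rw [map_mul, map_inv, mul_inv_eq_one, map_list_prod, map_list_prod, List.map_map,
      List.map_map, ← Units.val_inj, ← Units.coeHom_apply, ← Units.coeHom_apply, map_list_prod,
      map_list_prod, List.map_map, List.map_map]
    have h : (fun l => ((isUnit_leftOp hD l).unit : Module.End k (W →₀ D.Coeff))) = D.leftOp := rfl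
    simpa [Function.comp_def, h] using prod_leftOp_braidWord hD i j))

theorem artinRep_of (hD : D.IsCompatible) (i : B) :
    artinRep hD (PresentedGroup.of i) = D.leftOp i := by
  simp [artinRep]

theorem artinRep_smul (hD : D.IsCompatible) (g : ArtinGroup M) (c : D.Coeff)
    (x : W →₀ D.Coeff) :
    artinRep hD g (c • x) = (g • c) • artinRep hD g x := by
  have hg : g ∈ Subgroup.closure (Set.range (PresentedGroup.of (rels := artinRelations M))) := by
    rw [PresentedGroup.closure_range_of]; trivial
  induction hg using Subgroup.closure_induction generalizing c x with
  | mem g hg =>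
    obtain ⟨i, rfl⟩ := hg
    rw [artinRep_of, leftOp_smul, smul_eq_act, artinProj_of]
  | one => simp
  | mul g h _ _ hg hh => rw [map_mul, Module.End.mul_apply, hh, hg, mul_smul]; rfl
  | inv g _ hg =>
    have h1 (y : W →₀ D.Coeff) : artinRep hD g (artinRep hD g⁻¹ y) = y := by
      rw [← Module.End.mul_apply, ← map_mul]; simp
    have h2 (y : W →₀ D.Coeff) : artinRep hD g⁻¹ (artinRep hD g y) = y := by
      rw [← Module.End.mul_apply, ← map_mul]; simp
    conv_lhs => rw [← h1 x, ← smul_inv_smul g c]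
    rw [← hg, h2]

theorem artinRep_artinWord (hD : D.IsCompatible) (ω : List B) :
    artinRep hD (artinWord M ω) = (ω.map D.leftOp).prod := by
  rw [artinWord, map_list_prod, List.map_map]
  exact congrArg List.prod (List.map_congr_left fun i _ => artinRep_of hD i)

theorem lsmul_mul_artinRep (hD : D.IsCompatible) (g : ArtinGroup M) (c : D.Coeff) :
    Algebra.lsmul k k (W →₀ D.Coeff) (g • c) * artinRep hD g =
      artinRep hD g * Algebra.lsmul k k (W →₀ D.Coeff) c :=
  LinearMap.ext fun x => (artinRep_smul hD g c x).symm

theorem artinRep_of_mul_self (hD : D.IsCompatible) (i : B) :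
    artinRep hD (PresentedGroup.of i) * artinRep hD (PresentedGroup.of i) =
      Algebra.lsmul k k (W →₀ D.Coeff) (D.param i) +
        Algebra.lsmul k k (W →₀ D.Coeff) (1 - D.param i) *
          artinRep hD (PresentedGroup.of i) := by
  rw [artinRep_of]
  exact LinearMap.ext fun x => leftOp_leftOp hD i x

/-- The regular representation of the Marin algebra on the free module with basis `W`. -/
def regularRep (hD : D.IsCompatible) : D.MarinAlgebra →ₐ[k] Module.End k (W →₀ D.Coeff) :=
  D.liftHom (C := Module.End k (W →₀ D.Coeff)) (Algebra.lsmul k k (W →₀ D.Coeff)) (artinRep hD)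
    (lsmul_mul_artinRep hD) (artinRep_of_mul_self hD)

/-! ### The standard basis -/

variable (D) in
/-- The element `g_w` of the Marin algebra. -/
def genWord (w : W) : D.MarinAlgebra := D.gen (artinWord M (cs.exists_isReduced w).choose)

theorem genWord_wordProd {ω : List B} (hω : cs.IsReduced ω) :
    D.genWord (cs.wordProd ω) = D.gen (artinWord M ω) := by
  have h := (cs.exists_isReduced (cs.wordProd ω)).choose_spec
  rw [genWord, artinWord_eq_of_isReduced cs h.1 hω h.2.symm]

theorem gen_of_mul_genWord {w : W} {i : B} (h : ¬cs.IsLeftDescent w i) :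
    D.gen (PresentedGroup.of i) * D.genWord w = D.genWord (cs.simple i * w) := by
  obtain ⟨ω, hω, rfl⟩ := cs.exists_isReduced w
  have hred : cs.IsReduced (i :: ω) := by
    rw [CoxeterSystem.IsReduced, wordProd_cons, cs.not_isLeftDescent_iff.mp h, hω.eq,
      List.length_cons]
  rw [← wordProd_cons, genWord_wordProd hω, genWord_wordProd hred, artinWord_cons, map_mul]

theorem gen_of_mul_mem_span (i : B) {x : D.MarinAlgebra}
    (hx : x ∈ Submodule.span D.Coeff (Set.range D.genWord)) :
    D.gen (PresentedGroup.of i) * x ∈ Submodule.span D.Coeff (Set.range D.genWord) := by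
  induction hx using Submodule.span_induction with
  | mem x hx =>
    obtain ⟨w, rfl⟩ := hx
    by_cases h : cs.IsLeftDescent w i
    · have h' : ¬cs.IsLeftDescent (cs.simple i * w) i := by
        rw [IsLeftDescent, simple_mul_simple_cancel_left]; exact lt_asymm h
      have hw := gen_of_mul_genWord (D := D) h'
      rw [simple_mul_simple_cancel_left] at hw
      rw [← hw, gen_of_mul_gen_of_mul, hw]
      exact add_mem (Submodule.smul_mem _ _ (Submodule.subset_span ⟨_, rfl⟩))
        (Submodule.smul_mem _ _ (Submodule.subset_span ⟨_, rfl⟩))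
    · rw [gen_of_mul_genWord h]
      exact Submodule.subset_span ⟨_, rfl⟩
  | zero => simp
  | add x y _ _ hx hy => rw [mul_add]; exact add_mem hx hy
  | smul c x _ hx => rw [gen_mul_smul]; exact Submodule.smul_mem _ _ hx

theorem gen_of_inv_mul_mem_span (i : B) {x : D.MarinAlgebra}
    (hx : x ∈ Submodule.span D.Coeff (Set.range D.genWord)) :
    D.gen (PresentedGroup.of i)⁻¹ * x ∈ Submodule.span D.Coeff (Set.range D.genWord) := by
  obtain ⟨b, hb⟩ := (D.isUnit_param i).exists_left_inv
  have hb' : D.act (cs.simple i) b * D.param i = 1 := by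
    rw [← D.act_simple_param i, ← map_mul, hb, map_one]
  have key : D.gen (PresentedGroup.of i)⁻¹ * x =
      b • (D.gen (PresentedGroup.of i) * x - (1 - D.param i) • x) := by
    have h : D.gen (PresentedGroup.of i) *
        (b • (D.gen (PresentedGroup.of i) * x - (1 - D.param i) • x)) = x := by
      rw [gen_mul_smul, mul_sub, gen_of_mul_gen_of_mul, gen_mul_smul, artinProj_of, map_sub,
        map_one, act_simple_param, add_sub_cancel_right, smul_smul, hb', one_smul]
    conv_lhs => rw [← h]
    rw [← mul_assoc, ← map_mul, inv_mul_cancel, map_one, one_mul]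
  rw [key]
  exact Submodule.smul_mem _ _ (sub_mem (gen_of_mul_mem_span i hx) (Submodule.smul_mem _ _ hx))

/-- The span contains `1` and is stable under left multiplication by the generators and their
inverses, hence contains every `g` in the image of the Artin group; the products `c g` generate the
algebra additively. -/
theorem span_range_genWord : Submodule.span D.Coeff (Set.range D.genWord) = ⊤ := by
  have hone : (1 : D.MarinAlgebra) ∈ Submodule.span D.Coeff (Set.range D.genWord) := by
    refine Submodule.subset_span ⟨1, ?_⟩
    have h := genWord_wordProd (D := D) (cs := cs) (ω := []) (by simp [CoxeterSystem.IsReduced])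
    simpa [artinWord] using h
  have hgen (g : ArtinGroup M) : ∀ x ∈ Submodule.span D.Coeff (Set.range D.genWord),
      D.gen g * x ∈ Submodule.span D.Coeff (Set.range D.genWord) ∧
      D.gen g⁻¹ * x ∈ Submodule.span D.Coeff (Set.range D.genWord) := by
    have hg : g ∈ Subgroup.closure (Set.range (PresentedGroup.of (rels := artinRelations M))) := by
      rw [PresentedGroup.closure_range_of]; trivial
    induction hg using Subgroup.closure_induction with
    | mem g hg =>
      obtain ⟨i, rfl⟩ := hg
      exact fun x hx => ⟨gen_of_mul_mem_span i hx, gen_of_inv_mul_mem_span i hx⟩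
    | one => simp
    | mul g h _ _ hg hh =>
      intro x hx
      rw [mul_inv_rev, map_mul, map_mul, mul_assoc, mul_assoc]
      exact ⟨(hg _ (hh x hx).1).1, (hh _ (hg x hx).2).2⟩
    | inv g _ hg =>
      intro x hx
      rw [inv_inv]
      exact (hg x hx).symm
  rw [eq_top_iff]
  intro x _
  obtain ⟨y, rfl⟩ := D.quotientMap_surjective x
  induction y using SkewMonoidAlgebra.induction_on with
  | zero => simp
  | single g c =>
    rw [quotientMap_single]
    refine Submodule.smul_mem _ _ ?_
    simpa using (hgen g 1 hone).1
  | add x y hx hy => rw [map_add]; exact add_mem (hx trivial) (hy trivial)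

/-- The evaluation of the regular representation at the basis vector `1`. -/
def evalOne (hD : D.IsCompatible) : D.MarinAlgebra →ₗ[D.Coeff] (W →₀ D.Coeff) where
  toFun x := regularRep hD x (Finsupp.single 1 1)
  map_add' x y := by rw [map_add, LinearMap.add_apply]
  map_smul' c x := by
    rw [coeff_smul_def, map_mul, regularRep, liftHom_coeffHom]
    rfl

theorem evalOne_genWord (hD : D.IsCompatible) (w : W) :
    evalOne hD (D.genWord w) = Finsupp.single w 1 := by
  obtain ⟨ω, hω, rfl⟩ := cs.exists_isReduced w
  rw [genWord_wordProd hω]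
  change regularRep hD (D.gen (artinWord M ω)) (Finsupp.single 1 1) = _
  rw [regularRep, liftHom_gen, artinRep_artinWord, prod_leftOp_single_one hω]

theorem linearIndependent_genWord (hD : D.IsCompatible) :
    LinearIndependent D.Coeff D.genWord := by
  refine LinearIndependent.of_comp (evalOne hD) ?_
  have h : evalOne hD ∘ D.genWord = Finsupp.basisSingleOne (R := D.Coeff) (ι := W) := by
    funext w
    simp [evalOne_genWord]
  rw [h]
  exact Module.Basis.linearIndependent _

/-- The basis `(g_w)` of the Marin algebra. -/
def stdBasis (hD : D.IsCompatible) : Module.Basis W D.Coeff D.MarinAlgebra :=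
  Module.Basis.mk (linearIndependent_genWord hD) span_range_genWord.ge

theorem stdBasis_wordProd (hD : D.IsCompatible) {ω : List B} (hω : cs.IsReduced ω) :
    stdBasis hD (cs.wordProd ω) = D.gen (artinWord M ω) := by
  rw [stdBasis, Module.Basis.mk_apply, genWord_wordProd hω]

end MarinDatum

namespace MarinDatum

/-! ### Functoriality in the coefficients -/

section Functoriality

variable {B W : Type*} [Group W] {M : CoxeterMatrix B} {cs : CoxeterSystem M W}
  {k A A' : Type*} [CommRing k] [CommRing A] [Algebra k A] [CommRing A'] [Algebra k A']
  (D : MarinDatum cs k A) (D' : MarinDatum cs k A')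

/-- The canonical map from the coefficients to the Marin algebra, as a homomorphism of algebras. -/
def coeffAlgHom : D.Coeff →ₐ[k] D.MarinAlgebra :=
  { D.coeffHom with
    commutes' := fun r => D.quotientMap.commutes r }

/-- An equivariant homomorphism of coefficient algebras that respects the parameters induces a
homomorphism of Marin algebras. -/
def mapHom (θ : A →ₐ[k] A') (hθ : ∀ w c, θ (D.ρ w c) = D'.ρ w (θ c))
    (ha : ∀ i, θ (D.a i) = D'.a i) : D.MarinAlgebra →ₐ[k] D'.MarinAlgebra :=
  D.liftHom
    (D'.coeffAlgHom.comp ((D'.toCoeff : A' →ₐ[k] D'.Coeff).comp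
      (θ.comp (D.toCoeff.symm : D.Coeff →ₐ[k] A)))) D'.gen
    (fun x c => by
      have h := D'.gen_mul_smul x (D'.toCoeff (θ (D.toCoeff.symm c))) 1
      rw [coeff_smul_def, coeff_smul_def, mul_one, mul_one] at h
      have h' : D'.act (artinProj cs x) (D'.toCoeff (θ (D.toCoeff.symm c))) =
          D'.toCoeff (θ (D.toCoeff.symm (x • c))) := by
        simp [act, artin_smul_def, hθ]
      rw [h'] at h
      exact h.symm)
    (fun i => by
      have h := D'.gen_of_mul_gen_of_mul i 1
      rw [coeff_smul_def, coeff_smul_def, mul_one, mul_one] at h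
      have h' : D'.toCoeff (θ (D.toCoeff.symm (D.param i))) = D'.param i := by
        simp [param, ha]
      rw [h, ← h', map_sub, map_one, map_sub, map_one]
      rfl)

section mapHom

variable (θ : A →ₐ[k] A') (hθ : ∀ w c, θ (D.ρ w c) = D'.ρ w (θ c))
  (ha : ∀ i, θ (D.a i) = D'.a i)

theorem mapHom_coeffHom (c : A) :
    D.mapHom D' θ hθ ha (D.coeffHom (D.toCoeff c)) = D'.coeffHom (D'.toCoeff (θ c)) :=
  D.liftHom_coeffHom _ _ _ _ _

theorem mapHom_gen (x : ArtinGroup M) : D.mapHom D' θ hθ ha (D.gen x) = D'.gen x :=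
  D.liftHom_gen _ _ _ _ _

theorem mapHom_surjective (hsurj : Function.Surjective θ) :
    Function.Surjective (D.mapHom D' θ hθ ha) := by
  intro y
  rw [← AlgHom.mem_range]
  obtain ⟨z, rfl⟩ := D'.quotientMap_surjective y
  induction z using SkewMonoidAlgebra.induction_on with
  | zero => rw [map_zero]; exact zero_mem _
  | single g c =>
    rw [quotientMap_single, coeff_smul_def]
    obtain ⟨b, hb⟩ := hsurj (D'.toCoeff.symm c)
    refine mul_mem ⟨D.coeffHom (D.toCoeff b), ?_⟩ ⟨D.gen g, D.mapHom_gen D' θ hθ ha g⟩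
    refine (D.mapHom_coeffHom D' θ hθ ha b).trans ?_
    rw [hb, AlgEquiv.apply_symm_apply]
  | add x y hx hy => rw [map_add]; exact add_mem hx hy

end mapHom

end Functoriality

end MarinDatum

/-! ### Monoid algebras -/

section Monoid

variable {B W E R : Type*} [Group W] {M : CoxeterMatrix B} [CommMonoid E] [CommRing R]

/-- The factor `1 - ê` equals `(1 - u) e`, so the claim reduces to `e x = e σ(x)` on monoid
elements. -/
theorem one_sub_hatUnit_mul_domCongr {σ : MulAut E} {e : E} (he : IsIdempotentElem e)
    (h : ∀ x, e * x = e * σ x) (u : Rˣ) (c : MonoidAlgebra R E) :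
    (1 - (hatUnit u e he).val) * MonoidAlgebra.domCongr R R σ c =
      (1 - (hatUnit u e he).val) * c := by
  have hparam : 1 - (hatUnit u e he).val = MonoidAlgebra.single e (1 - (u : R)) := by
    rw [hatUnit, sub_add_cancel_left, ← MonoidAlgebra.single_neg, neg_sub]
  rw [hparam]
  induction c using MonoidAlgebra.induction_linear with
  | zero => simp
  | add x y hx hy => rw [map_add, mul_add, hx, hy, mul_add]
  | single x r =>
    rw [MonoidAlgebra.domCongr_single, MonoidAlgebra.single_mul_single,
      MonoidAlgebra.single_mul_single, ← h]

theorem isCompatible_monoidDatum {cs : CoxeterSystem M W} {ρ : W →* MulAut E} {e : B → E}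
    (h : IsMarinIwahoriHeckeMonoid cs ρ e)
    (u : B → Rˣ) (hu : IsEquivariant cs (fun _ r => r) u) :
    (monoidDatum cs ρ e h.idempotent h.equivariant u hu).IsCompatible :=
  fun i c => one_sub_hatUnit_mul_domCongr (h.idempotent i) (h.mul_eq i) (u i) c

theorem augmentation_single (x : E) (r : R) :
    augmentation R E (MonoidAlgebra.single x r) = r := by
  simp [augmentation]

theorem augmentation_domCongr (σ : MulAut E) (c : MonoidAlgebra R E) :
    augmentation R E (MonoidAlgebra.domCongr R R σ c) = augmentation R E c := by
  induction c using MonoidAlgebra.induction_linear with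
  | zero => simp
  | add x y hx hy => simp only [map_add, hx, hy]
  | single x r => rw [MonoidAlgebra.domCongr_single, augmentation_single, augmentation_single]

theorem augmentation_hatUnit (u : Rˣ) {e : E} (he : IsIdempotentElem e) :
    augmentation R E (hatUnit u e he).val = u := by
  rw [hatUnit, map_add, map_one, augmentation_single, add_sub_cancel]

theorem augmentation_surjective : Function.Surjective (augmentation R E) :=
  fun r => ⟨MonoidAlgebra.single 1 r, augmentation_single 1 r⟩

/-- In `E_[e]`, the relations `e_s x = e_s (s.x)` follow from their special cases `x = w.e_t`. -/
theorem isMarinIwahoriHeckeMonoid_orbit {cs : CoxeterSystem M W} {ρ : W →* MulAut E} {e : B → E}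
    (hidem : ∀ i, IsIdempotentElem (e i)) (hequiv : IsEquivariant cs (fun w x => ρ w x) e)
    (hmul : ∀ (i j : B) (w : W), e i * ρ w (e j) = e i * ρ (cs.simple i * w) (e j)) :
    IsMarinIwahoriHeckeMonoid cs (orbitAction ρ e) (orbitMap ρ e) where
  idempotent i := Subtype.ext (hidem i)
  equivariant w i j h := Subtype.ext (hequiv w i j h)
  mul_eq := by
    rintro i ⟨x, hx⟩
    refine Subtype.ext ?_
    change e i * x = e i * ρ (cs.simple i) x
    induction hx using Submonoid.closure_induction with
    | mem x hx =>
      obtain ⟨w, j, rfl⟩ := hx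
      rw [hmul i j w, map_mul, MulAut.mul_apply]
    | one => rw [map_one]
    | mul x y _ _ hx hy =>
      -- Idempotence provides one copy of `e i` for each factor.
      calc e i * (x * y) = (e i * x) * (e i * y) := by
            rw [mul_mul_mul_comm, (hidem i).eq]
        _ = (e i * ρ (cs.simple i) x) * (e i * ρ (cs.simple i) y) := by rw [hx, hy]
        _ = e i * ρ (cs.simple i) (x * y) := by
            rw [mul_mul_mul_comm, (hidem i).eq, map_mul]

end Monoid

end BraidsTies

end

theorem mainTheorem2 {B W B' U : Type*} [Group W] [Group U] {M : CoxeterMatrix B}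
    {N : CoxeterMatrix B'} (cs : CoxeterSystem M W) (ct : CoxeterSystem N U) (φ : W →* U)
    (e : B → RootSubsystem ct) (h : IsJuyumayaMap cs ct φ e) {R : Type*} [CommRing R]
    (u : B → Rˣ) (hu : IsEquivariant cs (fun _ r => r) u) :
    IsMarinIwahoriHeckeMonoid cs (orbitAction (rhoPhi ct φ) e) (orbitMap (rhoPhi ct φ) e) ∧
    (∃ b : Module.Basis W (juyumayaDatum h u hu).Coeff (juyumayaDatum h u hu).MarinAlgebra,
      ∀ ω : List B, cs.IsReduced ω →
        b (cs.wordProd ω) = (juyumayaDatum h u hu).gen (artinWord M ω)) ∧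
    (∃ f : (juyumayaDatum h u hu).MarinAlgebra →ₐ[R] IwahoriHeckeAlgebra cs u hu,
      (∀ c : MonoidAlgebra R (SigmaOrbit ct φ e),
        f ((juyumayaDatum h u hu).coeffHom ((juyumayaDatum h u hu).toCoeff c)) =
          (heckeDatum cs u hu).coeffHom
            ((heckeDatum cs u hu).toCoeff (augmentation R (SigmaOrbit ct φ e) c))) ∧
      (∀ x : ArtinGroup M, f ((juyumayaDatum h u hu).gen x) = (heckeDatum cs u hu).gen x) ∧
      Function.Surjective f) := by
  -- The product of root subsystems is by definition the subsystem generated by their union, so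
  -- `h.generate_eq` is literally the required identity of products.
  have hE : IsMarinIwahoriHeckeMonoid cs (orbitAction (rhoPhi ct φ) e) (orbitMap (rhoPhi ct φ) e) :=
    isMarinIwahoriHeckeMonoid_orbit (fun i => RootSubsystem.mul_self (e i)) h.equivariant
      h.generate_eq
  have hD : (juyumayaDatum h u hu).IsCompatible := isCompatible_monoidDatum hE u hu
  have hθ (w : W) (c : MonoidAlgebra R (SigmaOrbit ct φ e)) :
      augmentation R (SigmaOrbit ct φ e) ((juyumayaDatum h u hu).ρ w c) =
        (heckeDatum cs u hu).ρ w (augmentation R (SigmaOrbit ct φ e) c) :=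
    augmentation_domCongr _ c
  have ha (i : B) : augmentation R (SigmaOrbit ct φ e) ((juyumayaDatum h u hu).a i) =
      (heckeDatum cs u hu).a i :=
    augmentation_hatUnit (u i) (hE.idempotent i)
  exact ⟨hE, ⟨MarinDatum.stdBasis hD, fun ω hω => MarinDatum.stdBasis_wordProd hD hω⟩,
    MarinDatum.mapHom _ _ _ hθ ha, MarinDatum.mapHom_coeffHom _ _ _ hθ ha,
    MarinDatum.mapHom_gen _ _ _ hθ ha,
    MarinDatum.mapHom_surjective _ _ _ hθ ha augmentation_surjective⟩
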